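/- Consider the three-user $M_T\times M_R$ MIMO interference channel, $M_T,M_R\ge 1$: in each channel use $t$, receiver $j\in\{1,2,3\}$ observes $$Y_j(t)=\sum_{i=1}^{3}H_{ji}X_i(t)+Z_j(t),$$ where $X_i(t)\in\mathbb{C}^{M_T}$ is sent by transmitter $i$ under the average power constraint $\frac1n\sum_{t=1}^n\mathbb{E}\|X_i(t)\|^2\le\rho$, the noise $Z_j(t)\in\mathbb{C}^{M_R}$ has i.i.d. circularly symmetric complex Gaussian entries of mean zero and unit variance, and the channel matrices $H_{ji}\in\mathbb{C}^{M_R\times M_T}$ are constant in $t$. The entries of all the matrices $H_{ji}$ are drawn independently from continuous (that is, atomless) distributions on $\mathbb{C}$. Let $M=\min(M_T,M_R)$, $N=\max(M_T,M_R)$, $\kappa=\lceil M/(N-M)\rceil$ (with $\kappa=\infty$, $1/\kappa=0$ if $M=N$), and $$\mathrm{DoF}^\star=\min\Big(\frac{M}{2-1/\kappa},\frac{N}{2+1/\kappa}\Big),\qquad d=\lfloor\mathrm{DoF}^\star\rfloor .$$ Then $d$ degrees of freedom per user are achievable, for almost every channel realization, by linear beamforming and zero-forcing receivers without symbol extensions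 in time, frequency or space. That is, almost surely there are beamforming matrices $V_i\in\mathbb{C}^{M_T\times d}$ and receive filters $U_j\in\mathbb{C}^{d\times M_R}$, $i,j\in\{1,2,3\}$, such that 1. $U_jH_{ji}V_i=0$ for all $i\ne j$, and $\operatorname{rank}(U_jH_{jj}V_j)=d$ for all $j$; and 2. there are rates $R_k(\rho)$, $k\in\{1,2,3\}$, $\rho>0$, with $\lim_{\rho\to\infty}R_k(\rho)/\log\rho=d$ for each $k$, such that for every $\rho>0$ the tuple $(R_1(\rho),R_2(\rho),R_3(\rho))$ is achievable at power $\rho$, with average error probability tending to zero as the block length grows, by codes in which every transmitted vector has the form $X_i(t)=V_is_i(t)$ with $s_i(t)\in\mathbb{C}^d$ and in which receiver $j$ decodes its message from the vectors $U_jY_j(t)$ only. -/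

import Mathlib

open MeasureTheory ProbabilityTheory Filter Topology

noncomputable section

namespace MIMOIC

/-- The length `κ = ⌈M / (N - M)⌉` of the subspace alignment chain, for `M < N`. -/
def chainLength (M N : ℕ) : ℕ := ⌈(M : ℚ) / ((N : ℚ) - (M : ℚ))⌉₊

/-- `DoF⋆ = min (M / (2 - 1/κ), N / (2 + 1/κ))` with `M = min MT MR`, `N = max MT MR` and
`κ = ⌈M / (N - M)⌉`. If `MT = MR`, then `κ = ∞`, `1/κ = 0`, and the value is `M / 2`. -/
def dofStar (MT MR : ℕ) : ℚ :=
  let M := min MT MR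
  let N := max MT MR
  if M = N then (M : ℚ) / 2
  else min ((M : ℚ) / (2 - 1 / (chainLength M N : ℚ))) ((N : ℚ) / (2 + 1 / (chainLength M N : ℚ)))

/-- The channel matrices of a three-user `MT × MR` interference channel: `H j i` is the
`MR × MT` matrix from transmitter `i` to receiver `j`. -/
abbrev Channel (MT MR : ℕ) : Type := Fin 3 → Fin 3 → Matrix (Fin MR) (Fin MT) ℂ

/-- The joint law of independent channel coefficients, `ν j i r c` being the law of the
coefficient from antenna `c` of transmitter `i` to antenna `r` of receiver `j`. -/
def channelLaw {MT MR : ℕ} (ν : Fin 3 → Fin 3 → Fin MR → Fin MT → Measure ℂ) :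
    Measure (Fin 3 → Fin 3 → Fin MR → Fin MT → ℂ) :=
  Measure.pi fun j => Measure.pi fun i => Measure.pi fun r => Measure.pi fun c => ν j i r c

/-- The circularly symmetric complex Gaussian law with mean zero and unit variance: real and
imaginary parts are independent real Gaussians of mean `0` and variance `1/2`. -/
def complexGaussian : Measure ℂ :=
  ((gaussianReal 0 (1 / 2)).prod (gaussianReal 0 (1 / 2))).map
    fun p : ℝ × ℝ => (p.1 : ℂ) + (p.2 : ℂ) * Complex.I

/-- The law of the noise at the three receivers over `n` channel uses: all entries are
independent and distributed as `complexGaussian`. -/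
def noiseLaw (MR n : ℕ) : Measure (Fin 3 → Fin n → Fin MR → ℂ) :=
  Measure.pi fun _ => Measure.pi fun _ => Measure.pi fun _ => complexGaussian

/-- A code of block length `n` for the three-user `MT × MR` interference channel: user `k` has
`size k` messages; transmitter `k` maps its own message to the vectors that it sends in the `n`
channel uses, and receiver `k` estimates that message from the vectors that it receives. -/
structure Code (MT MR n : ℕ) where
  size : Fin 3 → ℕ
  enc : (k : Fin 3) → Fin (size k) → Fin n → Fin MT → ℂ
  dec : (k : Fin 3) → (Fin n → Fin MR → ℂ) → Fin (size k)
  measurable_dec : ∀ k, Measurable (dec k)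

namespace Code

variable {MT MR n d : ℕ}

/-- The average power `(1/n) ∑ₜ 𝔼 ‖X_k(t)‖²` of transmitter `k`, for a uniform message. -/
def avgPower (c : Code MT MR n) (k : Fin 3) : ℝ :=
  (∑ w : Fin (c.size k), (∑ t : Fin n, ∑ a : Fin MT, ‖c.enc k w t a‖ ^ 2) / (n : ℝ)) /
    (c.size k : ℝ)

/-- What receiver `j` receives, `Y_j(t) = ∑ᵢ H_{ji} X_i(t) + Z_j(t)`, when the messages `w` are
sent and the noise is `z`. -/
def received (c : Code MT MR n) (H : Channel MT MR) (w : (k : Fin 3) → Fin (c.size k))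
    (z : Fin 3 → Fin n → Fin MR → ℂ) (j : Fin 3) : Fin n → Fin MR → ℂ :=
  fun t => (∑ i : Fin 3, (H j i).mulVec (c.enc i (w i) t)) + z j t

/-- The probability, for independent uniform messages, that some receiver decodes its desired
message wrongly. -/
def errorProb (c : Code MT MR n) (H : Channel MT MR) : ℝ :=
  (∑ w : (k : Fin 3) → Fin (c.size k),
      (noiseLaw MR n).real {z | ∃ j, c.dec j (c.received H w z j) ≠ w j}) /
    ∏ k, (c.size k : ℝ)

/-- The code uses linear beamforming with matrices `V` and linear receive filters `U`, separately
in every channel use: the vector sent by transmitter `k` at each time is `V k` times a vector of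
`d` stream symbols, and receiver `k` decodes from the filtered outputs `U k * Y_k(t)` only. -/
def IsLinear (c : Code MT MR n) (V : Fin 3 → Matrix (Fin MT) (Fin d) ℂ)
    (U : Fin 3 → Matrix (Fin d) (Fin MR) ℂ) : Prop :=
  (∀ k w t, ∃ s : Fin d → ℂ, c.enc k w t = (V k).mulVec s) ∧
  (∀ k, ∃ g : (Fin n → Fin d → ℂ) → Fin (c.size k),
    ∀ y, c.dec k y = g fun t => (U k).mulVec (y t))

end Code

/-- The receive filters `U` null all interference under the beamforming matrices `V`, and leave
`d` resolvable dimensions of the desired signal to every user. -/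
structure IsZeroForcing {MT MR d : ℕ} (H : Channel MT MR)
    (V : Fin 3 → Matrix (Fin MT) (Fin d) ℂ) (U : Fin 3 → Matrix (Fin d) (Fin MR) ℂ) : Prop where
  interference : ∀ i j, i ≠ j → U j * H j i * V i = 0
  desired : ∀ j, (U j * H j j * V j).rank = d

/-- The rate tuple `R` (in nats per channel use) is achievable at power `ρ` by codes that use the
beamforming matrices `V` and the receive filters `U`: for every `ε > 0` and every sufficiently
large block length there is such a code with these rates, power at most `ρ` and error
probability at most `ε`. -/
def LinearlyAchievable {MT MR d : ℕ} (H : Channel MT MR)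
    (V : Fin 3 → Matrix (Fin MT) (Fin d) ℂ) (U : Fin 3 → Matrix (Fin d) (Fin MR) ℂ)
    (ρ : ℝ) (R : Fin 3 → ℝ) : Prop :=
  ∀ ε : ℝ, 0 < ε → ∀ᶠ n : ℕ in atTop, ∃ c : Code MT MR n,
    c.IsLinear V U ∧ (∀ k, c.avgPower k ≤ ρ) ∧
    (∀ k, Real.exp ((n : ℝ) * R k) ≤ (c.size k : ℝ)) ∧ c.errorProb H ≤ ε

/-- With `V` and `U` fixed for all powers, every user achieves `δ` degrees of freedom: there are
achievable rates `R_k(ρ)` with `R_k(ρ) / log ρ → δ` as `ρ → ∞`. -/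
def LinearlyAchievesDoF {MT MR d : ℕ} (H : Channel MT MR)
    (V : Fin 3 → Matrix (Fin MT) (Fin d) ℂ) (U : Fin 3 → Matrix (Fin d) (Fin MR) ℂ)
    (δ : ℝ) : Prop :=
  ∃ R : ℝ → Fin 3 → ℝ, (∀ ρ : ℝ, 0 < ρ → LinearlyAchievable H V U ρ (R ρ)) ∧
    ∀ k, Tendsto (fun ρ => R ρ k / Real.log ρ) atTop (𝓝 δ)

end MIMOIC

end

namespace MIMOIC

/-! Alignment. With M transmit and N receive antennas, M < N, the interference at receiver `j` fills
the sum of two images of beam spaces, and this sum loses exactly the dimension of the part of the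
kernel of `[h j (j + 1), h j (j + 2)]` that lies in the product of the two beam spaces. Generically
this kernel has dimension 2M - N (when nonnegative), and its basis vectors, cut in two halves, form
another three-user channel with M receive and 2M - N transmit antennas. Aligning that smaller
channel aligns the original one (`alignable_of_kernel`). Each such reflection preserves N - M, and
also b - a for beam dimension a and interference dimension b. With a = d and b = N - d, the
condition that no alignment is needed after κ - 1 reflections, and the condition that the beams
still fit there, are the two bounds in `dofStar` (`generically_alignable`). For M = N an invariant
subspace of a product of channel matrices does the work; for more transmit than receive antennas,
transposing exchanges beams and filters.

Genericity. Every exceptional set is contained in the zero set of an entire function that does not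
vanish identically, and such sets are null for products of atomless laws (`AvoidsZeros.pi`). Beams
and filters depend on the cross channels only, so the independent direct channels almost surely stay
invertible between them (`ae_zeroForceable`).

Rates. Zero-forcing leaves d interference-free streams per user with additive noise. Square
constellations with spacing log ρ, hard decisions and a Gilbert–Varshamov outer code suffice: the
symbol error probability tends to zero, so the redundancy is a vanishing fraction of the rate, and
each stream carries log ρ to first order (`linearlyAchievesDoF`). -/

/-! ### Zero sets of entire functions and product measures -/

/-- By the identity theorem the zeros form a closed discrete set, and a discrete subspace of the
separable plane is countable. -/
theorem countable_zeros_of_differentiable {f : ℂ → ℂ} (hf : Differentiable ℂ f)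
    (h : ∃ x, f x ≠ 0) : {x | f x = 0}.Countable := by
  have hA : AnalyticOnNhd ℂ f Set.univ := fun x _ => hf.analyticAt x
  rcases hA.eqOn_zero_or_eventually_ne_zero_of_preconnected isPreconnected_univ with h0 | h0
  · obtain ⟨x, hx⟩ := h
    exact absurd (h0 (Set.mem_univ x)) hx
  · have : {x | f x = 0} = {x | f x ≠ 0}ᶜ := by ext; simp
    rw [this]
    have h1 : {x | f x ≠ 0} ∈ codiscrete ℂ := h0
    have h2 : IsClosed {x | f x ≠ 0}ᶜ ∧ IsDiscrete {x | f x ≠ 0}ᶜ := by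
      simpa [mem_codiscrete'] using h1
    have := h2.2
    rw [isDiscrete_iff_discreteTopology] at this
    exact Set.countable_coe_iff.mp (TopologicalSpace.separableSpace_iff_countable.mp inferInstance)

/-- Two entire functions that do not vanish identically are nonzero at a common point. -/
theorem exists_ne_zero_and_ne_zero {E : Type*} [NormedAddCommGroup E] [NormedSpace ℂ E]
    {f g : E → ℂ} (hf : Differentiable ℂ f) (hg : Differentiable ℂ g)
    (hf0 : ∃ x, f x ≠ 0) (hg0 : ∃ x, g x ≠ 0) : ∃ x, f x ≠ 0 ∧ g x ≠ 0 := by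
  obtain ⟨x, hx⟩ := hf0
  obtain ⟨y, hy⟩ := hg0
  -- On the complex line through the two points each function has only countably many zeros.
  let l : ℂ → E := fun t => x + t • (y - x)
  have hl : Differentiable ℂ l := by fun_prop
  have h1 := countable_zeros_of_differentiable (hf.comp hl) ⟨0, by simpa [l] using hx⟩
  have h2 := countable_zeros_of_differentiable (hg.comp hl) ⟨1, by simpa [l] using hy⟩
  have h3 := (h1.union h2).dense_compl ℂ
  obtain ⟨t, ht⟩ := h3.nonempty
  refine ⟨l t, ?_⟩
  simpa [not_or] using ht

/-- A measure under which entire functions that do not vanish identically are almost everywhere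
nonzero. -/
def AvoidsZeros {E : Type*} [NormedAddCommGroup E] [NormedSpace ℂ E] [MeasurableSpace E]
    (μ : Measure E) : Prop :=
  ∀ f : E → ℂ, Differentiable ℂ f → (∃ x, f x ≠ 0) → ∀ᵐ x ∂μ, f x ≠ 0

theorem avoidsZeros_of_atomless (ν : Measure ℂ) (hν : ∀ z, ν {z} = 0) : AvoidsZeros ν := by
  intro f hf h0
  rw [ae_iff]
  simp only [not_not]
  have : NullSingletonClass ν := ⟨hν⟩
  exact Set.Countable.measure_zero (countable_zeros_of_differentiable hf h0) ν

/-- Fubini, one coordinate at a time: the slices of an entire function are entire. -/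
theorem AvoidsZeros.pi {E : Type*} [NormedAddCommGroup E] [NormedSpace ℂ E] [MeasurableSpace E]
    [BorelSpace E] [SecondCountableTopology E] {n : ℕ} (μ : Fin n → Measure E)
    [∀ i, IsProbabilityMeasure (μ i)] (h : ∀ i, AvoidsZeros (μ i)) :
    AvoidsZeros (Measure.pi μ) := by
  induction n with
  | zero =>
    rintro f - ⟨x, hx⟩
    exact Eventually.of_forall fun y => by rwa [Subsingleton.elim y x]
  | succ n ih =>
    rintro f hf ⟨x, hx⟩
    have hp := (measurePreserving_piFinSuccAbove μ 0).symm
    have hS : MeasurableSet {x | f x ≠ 0} :=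
      hf.continuous.measurable (measurableSet_singleton (0 : ℂ)).compl
    rw [← hp.map_eq, ae_map_iff hp.measurable.aemeasurable hS]
    have hm : Measurable fun p : E × (Fin n → E) =>
        f ((MeasurableEquiv.piFinSuccAbove (fun _ => E) 0).symm p) :=
      hf.continuous.measurable.comp hp.measurable
    have hS' : MeasurableSet {p : E × (Fin n → E) |
        f ((MeasurableEquiv.piFinSuccAbove (fun _ => E) 0).symm p) ≠ 0} :=
      hm (measurableSet_singleton (0 : ℂ)).compl
    have key : ∀ᵐ p ∂((Measure.pi fun j => μ (Fin.succAbove 0 j)).prod (μ 0)),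
        f ((MeasurableEquiv.piFinSuccAbove (fun _ => E) 0).symm p.swap) ≠ 0 := by
      have hS'' : MeasurableSet {p : (Fin n → E) × E |
          f ((MeasurableEquiv.piFinSuccAbove (fun _ => E) 0).symm p.swap) ≠ 0} :=
        measurable_swap hS'
      rw [Measure.ae_prod_iff_ae_ae hS'']
      -- With the first coordinate frozen at `x 0` the function is nonzero for almost every tail
      -- `y`; for each such `y`, the slice in the first coordinate is nonzero at `x 0`, hence almost
      -- everywhere.
      have h1 := ih (fun j => μ (Fin.succAbove 0 j)) (fun j => h _)
        (fun y => f (Fin.cons (x 0) y)) (hf.comp (by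
          rw [differentiable_pi]
          intro i
          refine Fin.cases ?_ (fun j => ?_) i
          · simp
          · simp only [Fin.cons_succ]; fun_prop)) ⟨Fin.tail x, by simpa using hx⟩
      filter_upwards [h1] with y hy
      have := h 0 (fun a => f (Fin.cons a y)) (hf.comp (by
          rw [differentiable_pi]
          intro i
          refine Fin.cases ?_ (fun j => ?_) i
          · simp
          · simp)) ⟨x 0, hy⟩
      filter_upwards [this] with a ha
      simpa [MeasurableEquiv.piFinSuccAbove, Fin.insertNthEquiv] using ha
    have hsw : Measure.prod (μ 0) (Measure.pi fun j => μ (Fin.succAbove 0 j)) =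
        (Measure.prod (Measure.pi fun j => μ (Fin.succAbove 0 j)) (μ 0)).map Prod.swap :=
      Measure.prod_swap.symm
    rw [hsw, ae_map_iff measurable_swap.aemeasurable hS']
    exact key

/-! ### Resampling coordinates of a product measure -/

/-- The preimage of a box is a box with its `i`-th side freed, times that side; the freed side
contributes a factor 1. -/
theorem measurePreserving_update {ι : Type*} [Fintype ι] [DecidableEq ι] {α : ι → Type*}
    [∀ i, MeasurableSpace (α i)] (μ : ∀ i, Measure (α i)) [∀ i, IsProbabilityMeasure (μ i)]
    (i : ι) :
    MeasurePreserving (fun p : (∀ k, α k) × α i => Function.update p.1 i p.2)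
      ((Measure.pi μ).prod (μ i)) (Measure.pi μ) := by
  have hm : Measurable (fun p : (∀ k, α k) × α i => Function.update p.1 i p.2) := by
    refine measurable_pi_iff.mpr fun k => ?_
    by_cases hk : k = i
    · subst hk; simpa using measurable_snd
    · simp only [Function.update_of_ne hk]; fun_prop
  refine ⟨hm, (Measure.pi_eq fun s hs => ?_).symm⟩
  rw [Measure.map_apply hm (MeasurableSet.univ_pi hs)]
  have : (fun p : (∀ k, α k) × α i => Function.update p.1 i p.2) ⁻¹' Set.univ.pi s =
      (Set.univ.pi (Function.update s i Set.univ)) ×ˢ s i := by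
    ext ⟨a, b⟩
    simp only [Set.mem_preimage, Set.mem_pi, Set.mem_univ, true_imp_iff, Set.mem_prod]
    constructor
    · intro h
      refine ⟨fun k => ?_, by simpa using h i⟩
      by_cases hk : k = i
      · subst hk; simp
      · simpa [Function.update_of_ne hk] using h k
    · rintro ⟨h1, h2⟩ k
      by_cases hk : k = i
      · subst hk; simpa using h2
      · simpa [Function.update_of_ne hk] using h1 k
  rw [this, Measure.prod_prod, Measure.pi_pi, ← Finset.prod_erase_mul _ _ (Finset.mem_univ i),
    ← Finset.prod_erase_mul _ (fun k => (μ k) (s k)) (Finset.mem_univ i)]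
  simp only [Function.update_self, measure_univ, mul_one]
  congr 1
  refine Finset.prod_congr rfl fun k hk => ?_
  rw [Function.update_of_ne (Finset.ne_of_mem_erase hk)]

/-- Resampling the diagonal of an independent array does not change its law. -/
theorem measurePreserving_update_diagonal {ι : Type*} [Fintype ι] [DecidableEq ι] {E : Type*}
    [MeasurableSpace E] (μ : ι → ι → Measure E) [∀ j i, IsProbabilityMeasure (μ j i)] :
    MeasurePreserving (fun (p : (ι → ι → E) × (ι → E)) j => Function.update (p.1 j) j (p.2 j))
      ((Measure.pi fun j => Measure.pi (μ j)).prod (Measure.pi fun j => μ j j))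
      (Measure.pi fun j => Measure.pi (μ j)) := by
  have h1 := measurePreserving_pi (fun j => (Measure.pi (μ j)).prod (μ j j))
    (fun j => Measure.pi (μ j)) (fun j => measurePreserving_update (μ j) j)
  exact h1.comp (measurePreserving_arrowProdEquivProdArrow (ι → E) E ι
    (fun j => Measure.pi (μ j)) (fun j => μ j j)).symm

/-! ### Determinants as entire functions, and generic properties -/

theorem differentiable_finsetProd {E ι : Type*} [NormedAddCommGroup E] [NormedSpace ℂ E]
    {s : Finset ι} {f : ι → E → ℂ} (hf : ∀ i, Differentiable ℂ (f i)) :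
    Differentiable ℂ fun x => ∏ i ∈ s, f i x := by
  classical
  exact fun x => (HasFDerivAt.finsetProd fun i _ => (hf i x).hasFDerivAt).differentiableAt

theorem differentiable_det {E ι : Type*} [NormedAddCommGroup E] [NormedSpace ℂ E] [Fintype ι]
    [DecidableEq ι] {A : E → Matrix ι ι ℂ} (hA : ∀ i j, Differentiable ℂ fun x => A x i j) :
    Differentiable ℂ fun x => (A x).det := by
  simp only [Matrix.det_apply]
  refine Differentiable.fun_sum fun σ _ => ?_
  refine Differentiable.fun_const_smul ?_ _
  exact differentiable_finsetProd fun i => hA (σ i) i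

theorem differentiable_adjugate {E ι : Type*} [NormedAddCommGroup E] [NormedSpace ℂ E] [Fintype ι]
    [DecidableEq ι] {A : E → Matrix ι ι ℂ} (hA : ∀ i j, Differentiable ℂ fun x => A x i j)
    (i j : ι) : Differentiable ℂ fun x => (A x).adjugate i j := by
  simp only [Matrix.adjugate_apply]
  refine differentiable_det fun k l => ?_
  by_cases hk : k = j
  · subst hk; simp
  · simpa [Matrix.updateRow_ne hk] using hA k l

/-- `P` holds off the zero set of an entire function that does not vanish identically. -/
def Generically {E : Type*} [NormedAddCommGroup E] [NormedSpace ℂ E] (P : E → Prop) : Prop :=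
  ∃ f : E → ℂ, Differentiable ℂ f ∧ (∃ x, f x ≠ 0) ∧ ∀ x, f x ≠ 0 → P x

theorem Generically.ae {E : Type*} [NormedAddCommGroup E] [NormedSpace ℂ E] [MeasurableSpace E]
    {μ : Measure E} (hμ : AvoidsZeros μ) {P : E → Prop} (hP : Generically P) :
    ∀ᵐ x ∂μ, P x := by
  obtain ⟨f, hf, h0, h⟩ := hP
  filter_upwards [hμ f hf h0] with x hx using h x hx

/-! ### Alignment of interference subspaces -/

/-- There are `V i`, of dimension at least `a`, and `I j`, of dimension at most `b`, such that
every `h j i` with `i ≠ j` maps `V i` into `I j`. -/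
def Alignable {M N : ℕ} (h : Fin 3 → Fin 3 → Fin N → Fin M → ℂ) (a b : ℕ) : Prop :=
  ∃ (V : Fin 3 → Submodule ℂ (Fin M → ℂ)) (I : Fin 3 → Submodule ℂ (Fin N → ℂ)),
    (∀ i, a ≤ Module.finrank ℂ (V i)) ∧ (∀ j, Module.finrank ℂ (I j) ≤ b) ∧
    ∀ i j, i ≠ j → ∀ v ∈ V i, (Matrix.of (h j i)).mulVec v ∈ I j

theorem exists_le_finrank_eq {E : Type*} [AddCommGroup E] [Module ℂ E] [FiniteDimensional ℂ E]
    (S : Submodule ℂ E) {a : ℕ} (hS : Module.finrank ℂ S ≤ a) (ha : a ≤ Module.finrank ℂ E) :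
    ∃ T : Submodule ℂ E, S ≤ T ∧ Module.finrank ℂ T = a := by
  obtain ⟨k, rfl⟩ := Nat.exists_eq_add_of_le hS
  induction k generalizing S with
  | zero => exact ⟨S, le_rfl, rfl⟩
  | succ k ih =>
    have hne : S ≠ ⊤ := by
      rintro rfl
      rw [finrank_top] at ha
      omega
    obtain ⟨v, -, hv⟩ := SetLike.exists_of_lt (lt_top_iff_ne_top.mpr hne)
    have hlt : S < S ⊔ Submodule.span ℂ {v} := by
      refine lt_of_le_of_ne le_sup_left fun heq => hv ?_
      rw [heq]
      exact Submodule.mem_sup_right (Submodule.mem_span_singleton_self v)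
    have h1 := Submodule.finrank_lt_finrank_of_lt hlt
    have h2 := Submodule.finrank_add_le_finrank_add_finrank S (Submodule.span ℂ {v})
    have h3 : Module.finrank ℂ (Submodule.span ℂ {v}) ≤ 1 := by
      simpa using finrank_span_le_card (R := ℂ) ({v} : Set E)
    have h4 : Module.finrank ℂ ↥(S ⊔ Submodule.span ℂ {v}) = Module.finrank ℂ S + 1 := by omega
    obtain ⟨T, hT, hT'⟩ := ih (S ⊔ Submodule.span ℂ {v}) (by omega) (by omega)
    exact ⟨T, le_sup_left.trans hT, by omega⟩

theorem eq_add_one_or_eq_add_two {i j : Fin 3} (h : i ≠ j) : i = j + 1 ∨ i = j + 2 := by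
  revert i j; decide

theorem add_one_ne (j : Fin 3) : j + 1 ≠ j := by revert j; decide

theorem add_two_ne (j : Fin 3) : j + 2 ≠ j := by revert j; decide

/-- The end of the chain: there is room for both interfering images without any overlap. -/
theorem alignable_of_two_mul_le {M N a b : ℕ} (ha : a ≤ M) (hab : 2 * a ≤ b)
    (h : Fin 3 → Fin 3 → Fin N → Fin M → ℂ) : Alignable h a b := by
  obtain ⟨W, -, hW⟩ := exists_le_finrank_eq (⊥ : Submodule ℂ (Fin M → ℂ)) (a := a) (by simp)
    (by simpa using ha)
  refine ⟨fun _ => W, fun j => W.map (Matrix.of (h j (j + 1))).mulVecLin ⊔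
    W.map (Matrix.of (h j (j + 2))).mulVecLin, fun _ => hW.ge, fun j => ?_, ?_⟩
  · have h1 := Submodule.finrank_add_le_finrank_add_finrank
      (W.map (Matrix.of (h j (j + 1))).mulVecLin) (W.map (Matrix.of (h j (j + 2))).mulVecLin)
    have h2 := Submodule.finrank_map_le (Matrix.of (h j (j + 1))).mulVecLin W
    have h3 := Submodule.finrank_map_le (Matrix.of (h j (j + 2))).mulVecLin W
    dsimp only
    omega
  · intro i j hij v hv
    rcases eq_add_one_or_eq_add_two hij with rfl | rfl
    · exact Submodule.mem_sup_left ⟨v, hv, rfl⟩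
    · exact Submodule.mem_sup_right ⟨v, hv, rfl⟩

/-- If the columns of `B (j + 1) j` stacked over `B (j + 2) j` are independent vectors of the kernel
of `[h j (j + 1), h j (j + 2)]`, then alignment for `B` gives alignment for `h`. -/
theorem alignable_of_kernel {M N M' a b : ℕ} (haM : a ≤ M) (hab : b ≤ 2 * a)
    (h : Fin 3 → Fin 3 → Fin N → Fin M → ℂ) (B : Fin 3 → Fin 3 → Fin M → Fin M' → ℂ)
    (hker : ∀ j, Matrix.of (h j (j + 1)) * Matrix.of (B (j + 1) j) +
      Matrix.of (h j (j + 2)) * Matrix.of (B (j + 2) j) = 0)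
    (hinj : ∀ j x, (Matrix.of (B (j + 1) j)).mulVec x = 0 →
      (Matrix.of (B (j + 2) j)).mulVec x = 0 → x = 0)
    (hB : Alignable B (2 * a - b) a) : Alignable h a b := by
  obtain ⟨K, V, hK, hV, hKV⟩ := hB
  -- The interference spaces of `B` become the beam spaces of `h`, enlarged to dimension exactly
  -- `a`.
  choose W hVW hW using fun i => exists_le_finrank_eq (V i) (hV i) (by simpa using haM)
  let φ : ∀ j, (W (j + 1) × W (j + 2)) →ₗ[ℂ] (Fin N → ℂ) := fun j =>
    ((Matrix.of (h j (j + 1))).mulVecLin.comp (W (j + 1)).subtype).coprod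
      ((Matrix.of (h j (j + 2))).mulVecLin.comp (W (j + 2)).subtype)
  refine ⟨W, fun j => LinearMap.range (φ j), fun i => (hW i).ge, fun j => ?_, ?_⟩
  · have h1 := LinearMap.finrank_range_add_finrank_ker (φ j)
    rw [Module.finrank_prod, hW, hW] at h1
    -- This embeds `K j` into the kernel of `φ j`, so the range of `φ j` has dimension at most 2a -
    -- (2a - b) = b.
    let ψ : K j →ₗ[ℂ] (W (j + 1) × W (j + 2)) :=
      (((Matrix.of (B (j + 1) j)).mulVecLin.comp (K j).subtype).codRestrict (W (j + 1))
        fun x => hVW _ (hKV j (j + 1) (add_one_ne j).symm x x.2)).prod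
      (((Matrix.of (B (j + 2) j)).mulVecLin.comp (K j).subtype).codRestrict (W (j + 2))
        fun x => hVW _ (hKV j (j + 2) (add_two_ne j).symm x x.2))
    have hψ : ∀ x, φ j (ψ x) = 0 := by
      intro x
      have := congrArg (fun A => A.mulVec (x : Fin M' → ℂ)) (hker j)
      simpa [φ, ψ, Matrix.add_mulVec, ← Matrix.mulVec_mulVec] using this
    have hψi : Function.Injective ψ := by
      rw [injective_iff_map_eq_zero]
      intro x hx
      have h1 : (Matrix.of (B (j + 1) j)).mulVec (x : Fin M' → ℂ) = 0 :=
        congrArg (fun p => (p.1 : Fin M → ℂ)) hx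
      have h2 : (Matrix.of (B (j + 2) j)).mulVec (x : Fin M' → ℂ) = 0 :=
        congrArg (fun p => (p.2 : Fin M → ℂ)) hx
      exact Subtype.ext (hinj j x h1 h2)
    have h2 := LinearMap.finrank_le_finrank_of_injective
      (f := ψ.codRestrict (LinearMap.ker (φ j)) hψ)
      (fun x y hxy => hψi (congrArg Subtype.val hxy))
    have h3 := hK j
    dsimp only
    omega
  · intro i j hij v hv
    rcases eq_add_one_or_eq_add_two hij with rfl | rfl
    · exact ⟨(⟨v, hv⟩, 0), by simp [φ]⟩
    · exact ⟨(0, ⟨v, hv⟩), by simp [φ]⟩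

/-! ### Reflection: passing to the channel formed by the kernels -/

section Reflection

variable {M N M' : ℕ}

/-- The matrix `[h j (j + 1), h j (j + 2)]`. -/
def incoming (h : Fin 3 → Fin 3 → Fin N → Fin M → ℂ) (j : Fin 3) :
    Matrix (Fin N) (Fin M ⊕ Fin M) ℂ :=
  Matrix.of fun r => Sum.elim (h j (j + 1) r) (h j (j + 2) r)

/-- The matrix `B (j + 1) j` stacked over `B (j + 2) j`. -/
def outgoing (B : Fin 3 → Fin 3 → Fin M → Fin M' → ℂ) (j : Fin 3) :
    Matrix (Fin M ⊕ Fin M) (Fin M') ℂ :=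
  Matrix.of (Sum.elim (B (j + 1) j) (B (j + 2) j))

/-- The array with diagonal `B` and with `C j` as its `outgoing` matrices. -/
def ofOutgoing (B : Fin 3 → Fin 3 → Fin M → Fin M' → ℂ)
    (C : Fin 3 → Matrix (Fin M ⊕ Fin M) (Fin M') ℂ) : Fin 3 → Fin 3 → Fin M → Fin M' → ℂ :=
  fun i j r c => if i = j + 1 then C j (Sum.inl r) c else if i = j + 2 then C j (Sum.inr r) c
    else B i j r c

/-- The array with zero diagonal and with `A j` as its `incoming` matrices. -/
def ofIncoming (A : Fin 3 → Matrix (Fin N) (Fin M ⊕ Fin M) ℂ) :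
    Fin 3 → Fin 3 → Fin N → Fin M → ℂ :=
  fun j i r c => if i = j + 1 then A j r (Sum.inl c) else if i = j + 2 then A j r (Sum.inr c)
    else 0

theorem incoming_ofIncoming (A : Fin 3 → Matrix (Fin N) (Fin M ⊕ Fin M) ℂ) (j : Fin 3) :
    incoming (ofIncoming A) j = A j := by
  ext r (c | c) <;> simp [incoming, ofIncoming]

theorem outgoing_ofOutgoing (B : Fin 3 → Fin 3 → Fin M → Fin M' → ℂ)
    (C : Fin 3 → Matrix (Fin M ⊕ Fin M) (Fin M') ℂ) (j : Fin 3) :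
    outgoing (ofOutgoing B C) j = C j := by
  ext (r | r) c <;> simp [outgoing, ofOutgoing]

theorem ofOutgoing_outgoing (B : Fin 3 → Fin 3 → Fin M → Fin M' → ℂ) :
    ofOutgoing B (outgoing B) = B := by
  funext i j r c
  unfold ofOutgoing outgoing
  split_ifs with h1 h2
  · subst h1; simp
  · subst h2; simp
  · rfl

theorem incoming_mul_outgoing (h : Fin 3 → Fin 3 → Fin N → Fin M → ℂ)
    (B : Fin 3 → Fin 3 → Fin M → Fin M' → ℂ) (j : Fin 3) :
    incoming h j * outgoing B j = Matrix.of (h j (j + 1)) * Matrix.of (B (j + 1) j) +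
      Matrix.of (h j (j + 2)) * Matrix.of (B (j + 2) j) := by
  ext r c
  simp [incoming, outgoing, Matrix.mul_apply, Fintype.sum_sum_type]

/-- A matrix over `Fin N ⊕ Fin M'` whose columns lie in the kernel of `A`. -/
def kernelColumns (A : Matrix (Fin N) (Fin N ⊕ Fin M') ℂ) (D : Matrix (Fin M') (Fin M') ℂ) :
    Matrix (Fin N ⊕ Fin M') (Fin M') ℂ :=
  Matrix.fromRows (-(A.toCols₁.adjugate * A.toCols₂ * D)) (A.toCols₁.det • D)

/-- For `A = [L, P]` this is `L * adjugate L = det L • 1`. Using the adjugate in place of the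
inverse keeps the kernel vectors polynomial in `A`, hence entire. -/
theorem mul_kernelColumns (A : Matrix (Fin N) (Fin N ⊕ Fin M') ℂ)
    (D : Matrix (Fin M') (Fin M') ℂ) : A * kernelColumns A D = 0 := by
  conv_lhs => rw [← Matrix.fromCols_toCols A]
  rw [kernelColumns, Matrix.fromCols_mul_fromRows]
  simp only [Matrix.toCols₁_fromCols, Matrix.toCols₂_fromCols]
  rw [Matrix.mul_neg, ← Matrix.mul_assoc, ← Matrix.mul_assoc, Matrix.mul_adjugate]
  simp

theorem differentiable_kernelColumns {E : Type*} [NormedAddCommGroup E] [NormedSpace ℂ E]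
    {A : E → Matrix (Fin N) (Fin N ⊕ Fin M') ℂ} (D : Matrix (Fin M') (Fin M') ℂ)
    (hA : ∀ r c, Differentiable ℂ fun x => A x r c) (s : Fin N ⊕ Fin M') (c : Fin M') :
    Differentiable ℂ fun x => kernelColumns (A x) D s c := by
  have hL : ∀ i j, Differentiable ℂ fun x => (A x).toCols₁ i j := fun i j => hA i (Sum.inl j)
  have hP : ∀ i j, Differentiable ℂ fun x => (A x).toCols₂ i j := fun i j => hA i (Sum.inr j)
  rcases s with s | s
  · simp only [kernelColumns, Matrix.fromRows_apply_inl, Matrix.neg_apply, Matrix.mul_apply]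
    refine Differentiable.fun_neg (Differentiable.fun_sum fun i _ => Differentiable.mul_const ?_ _)
    exact Differentiable.fun_sum fun k _ => (differentiable_adjugate hL _ _).mul (hP _ _)
  · simp only [kernelColumns, Matrix.fromRows_apply_inr, Matrix.smul_apply, smul_eq_mul]
    exact (differentiable_det hL).mul_const _

/-- The kernel channel `g h` is a polynomial function of `h`, so a function `f` detecting good
kernel channels pulls back to an entire function. It remains to see that the pullback is not
identically zero, for which one good kernel channel `B₀` is realized as `g h₀`. -/
theorem Generically.alignable_reflection {a b : ℕ} (hdim : M + M = N + M') (haM : a ≤ M)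
    (hab : b ≤ 2 * a)
    (hB : Generically fun B : Fin 3 → Fin 3 → Fin M → Fin M' → ℂ => Alignable B (2 * a - b) a) :
    Generically fun h : Fin 3 → Fin 3 → Fin N → Fin M → ℂ => Alignable h a b := by
  obtain ⟨f, hf, hf0, hfB⟩ := hB
  -- Any bijection serves: it only selects which N columns form the square block to be inverted.
  let e : Fin M ⊕ Fin M ≃ Fin N ⊕ Fin M' := Fintype.equivOfCardEq (by simpa using hdim)
  let bottom : (Fin 3 → Fin 3 → Fin M → Fin M' → ℂ) → Fin 3 → Matrix (Fin M') (Fin M') ℂ :=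
    fun B j => ((outgoing B j).submatrix e.symm id).toRows₂
  have hbot : ∀ j r c, Differentiable ℂ fun B => bottom B j r c := by
    intro j r c
    have : ∀ s, Differentiable ℂ fun B : Fin 3 → Fin 3 → Fin M → Fin M' → ℂ =>
        outgoing B j s c := by
      rintro (s | s) <;> simp only [outgoing, Matrix.of_apply, Sum.elim_inl, Sum.elim_inr] <;>
        fun_prop
    exact this _
  -- Besides being good, `B₀` must have invertible bottom blocks, since these normalize the kernel
  -- bases. They are the identity for the array whose stacked matrices are zero over one.
  obtain ⟨B₀, hB₀, hD₀⟩ := exists_ne_zero_and_ne_zero hf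
    (g := fun B => ∏ j, (bottom B j).det)
    (differentiable_finsetProd fun j => differentiable_det (hbot j)) hf0
    ⟨ofOutgoing 0 fun _ => (Matrix.fromRows 0 1).submatrix e id, by
      simp [bottom, outgoing_ofOutgoing, Matrix.submatrix_submatrix]⟩
  have hdet : ∀ j, (bottom B₀ j).det ≠ 0 := fun j =>
    (Finset.prod_ne_zero_iff.mp hD₀) j (Finset.mem_univ j)
  let A : (Fin 3 → Fin 3 → Fin N → Fin M → ℂ) → Fin 3 → Matrix (Fin N) (Fin N ⊕ Fin M') ℂ :=
    fun h j => (incoming h j).submatrix id e.symm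
  have hA : ∀ j r c, Differentiable ℂ fun h => A h j r c := by
    intro j r c
    have : ∀ s, Differentiable ℂ fun h : Fin 3 → Fin 3 → Fin N → Fin M → ℂ =>
        incoming h j r s := by
      rintro (s | s) <;> simp only [incoming, Matrix.of_apply, Sum.elim_inl, Sum.elim_inr] <;>
        fun_prop
    exact this _
  let C : (Fin 3 → Fin 3 → Fin N → Fin M → ℂ) → Fin 3 → Matrix (Fin M ⊕ Fin M) (Fin M') ℂ :=
    fun h j => (kernelColumns (A h j) (bottom B₀ j)).submatrix e id
  -- Kernels determine only the off-diagonal matrices; the diagonal is copied from `B₀` so that `g`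
  -- can take the value `B₀`.
  let g : (Fin 3 → Fin 3 → Fin N → Fin M → ℂ) → (Fin 3 → Fin 3 → Fin M → Fin M' → ℂ) :=
    fun h => ofOutgoing B₀ (C h)
  have hC : ∀ j s c, Differentiable ℂ fun h => C h j s c :=
    fun j s c => differentiable_kernelColumns _ (hA j) _ _
  have hg : Differentiable ℂ g := by
    rw [differentiable_pi]; intro i
    rw [differentiable_pi]; intro j
    rw [differentiable_pi]; intro r
    rw [differentiable_pi]; intro c
    by_cases h1 : i = j + 1
    · simpa [g, ofOutgoing, h1] using hC j (Sum.inl r) c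
    · by_cases h2 : i = j + 2
      · simpa [g, ofOutgoing, h2] using hC j (Sum.inr r) c
      · simp [g, ofOutgoing, h1, h2]
  refine ⟨fun h => f (g h) * ∏ j, (A h j).toCols₁.det, (hf.comp hg).mul
    (differentiable_finsetProd fun j => differentiable_det fun r c => hA j r _), ?_, ?_⟩
  · let T : Fin 3 → Matrix (Fin N) (Fin M') ℂ :=
      fun j => ((outgoing B₀ j).submatrix e.symm id).toRows₁
    -- If the stack of `B₀` is `T` over `D`, the kernel of `[1, -T * D⁻¹]` is spanned by exactly its
    -- columns, and the determinant of the left block is 1.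
    let h₀ : Fin 3 → Fin 3 → Fin N → Fin M → ℂ :=
      ofIncoming fun j => (Matrix.fromCols 1 (-(T j * (bottom B₀ j)⁻¹))).submatrix id e
    have hA₀ : ∀ j, A h₀ j = Matrix.fromCols 1 (-(T j * (bottom B₀ j)⁻¹)) := by
      intro j
      simp [A, h₀, incoming_ofIncoming, Matrix.submatrix_submatrix]
    have hg₀ : g h₀ = B₀ := by
      have : C h₀ = outgoing B₀ := by
        funext j
        have hk : kernelColumns (A h₀ j) (bottom B₀ j) =
            (outgoing B₀ j).submatrix e.symm id := by
          rw [← Matrix.fromRows_toRows ((outgoing B₀ j).submatrix e.symm id), kernelColumns, hA₀]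
          have hu : IsUnit (bottom B₀ j).det := isUnit_iff_ne_zero.mpr (hdet j)
          simp [Matrix.mul_assoc, Matrix.nonsing_inv_mul _ hu, T, bottom]
        simp only [C, hk, Matrix.submatrix_submatrix]
        ext; simp
      simp only [g, this, ofOutgoing_outgoing]
    exact ⟨h₀, by simp [hg₀, hB₀, hA₀]⟩
  · intro h hh
    obtain ⟨h1, h2⟩ := mul_ne_zero_iff.mp hh
    refine alignable_of_kernel haM hab h (g h) (fun j => ?_) (fun j x hx1 hx2 => ?_)
      (hfB _ h1)
    · rw [← incoming_mul_outgoing]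
      have := mul_kernelColumns (A h j) (bottom B₀ j)
      simp only [g, outgoing_ofOutgoing, C]
      have h3 : incoming h j = (A h j).submatrix id e := by
        ext; simp [A]
      rw [h3, Matrix.submatrix_mul_equiv, this, Matrix.submatrix_zero]
      rfl
    · have hC0 : (C h j).mulVec x = 0 := by
        rw [← outgoing_ofOutgoing B₀ (C h) j]
        funext s
        rcases s with s | s
        · exact congrFun hx1 s
        · exact congrFun hx2 s
      -- The bottom block alone, a nonzero multiple of an invertible matrix, already gives
      -- independence of the columns.
      have hb : ((A h j).toCols₁.det • bottom B₀ j).mulVec x = 0 := by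
        funext s
        have := congrFun hC0 (e.symm (Sum.inr s))
        simpa [C, Matrix.mulVec, kernelColumns, dotProduct] using this
      have hdd : (A h j).toCols₁.det ≠ 0 :=
        (Finset.prod_ne_zero_iff.mp h2) j (Finset.mem_univ j)
      rw [Matrix.smul_mulVec, smul_eq_zero_iff_right hdd] at hb
      exact Matrix.eq_zero_of_mulVec_eq_zero (hdet j) hb

end Reflection

/-! ### The alignment chain for unequal antenna numbers -/

/-- A reflection sends (M, N, a, b) to (2M - N, M, 2a - b, a), preserving N - M and b - a. After r
of them the first and third entries are M - r(N - M) and a - r(b - a). The three inequalities say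
that at that point the beams fit, no alignment is needed, and the number of antennas is nonnegative.
-/
theorem generically_alignable (r : ℕ) : ∀ {M N a b : ℕ}, M ≤ N → a ≤ M →
    (a : ℤ) - r * (b - a) ≤ M - r * (N - M) → (a : ℤ) - r * (b - a) ≤ b - a →
    (0 : ℤ) ≤ M - r * (N - M) →
    Generically fun h : Fin 3 → Fin 3 → Fin N → Fin M → ℂ => Alignable h a b := by
  have base : ∀ {M N a b : ℕ}, a ≤ M → 2 * a ≤ b →
      Generically fun h : Fin 3 → Fin 3 → Fin N → Fin M → ℂ => Alignable h a b :=
    fun ha hab => ⟨fun _ => 1, differentiable_const _, ⟨0, one_ne_zero⟩,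
      fun h _ => alignable_of_two_mul_le ha hab h⟩
  induction r with
  | zero =>
    intro M N a b _ ha _ h2 _
    exact base ha (by push_cast at h2; omega)
  | succ r ih =>
    intro M N a b hMN ha h1 h2 h3
    -- Stopping early here keeps the natural subtraction `2 * a - b` honest.
    by_cases hab : 2 * a ≤ b
    · exact base ha hab
    push_cast at h1 h2 h3
    have hNM : (N : ℤ) ≤ 2 * M := by
      have : (0 : ℤ) ≤ r * ((N : ℤ) - M) := mul_nonneg (by positivity) (by omega)
      linarith
    -- The excess of beam dimension over antennas is affine in the number of reflections. It is
    -- nonpositive after 0 and after `r + 1` of them, hence also after 1.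
    have ha' : (2 * a - b : ℤ) ≤ 2 * M - N := by
      have h4 : (a : ℤ) ≤ M := by exact_mod_cast ha
      by_contra hcon
      push Not at hcon
      have h5 : (r : ℤ) * (2 * M - N) ≤ r * (2 * a - b) :=
        mul_le_mul_of_nonneg_left hcon.le (by positivity)
      have h6 : (r : ℤ) * a ≤ r * M := mul_le_mul_of_nonneg_left h4 (by positivity)
      nlinarith
    have e1 : ((2 * a - b : ℕ) : ℤ) = 2 * a - b := by omega
    have e2 : ((2 * M - N : ℕ) : ℤ) = 2 * M - N := by omega
    refine Generically.alignable_reflection (M' := 2 * M - N) (by omega) ha (by omega)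
      (ih (by omega) (by omega) ?_ ?_ ?_)
    · rw [e1, e2]; linarith
    · rw [e1]; linarith
    · rw [e2]; linarith

/-! ### Equal antenna numbers -/

/-- Triangularization: an invariant subspace is enlarged by a lift of an eigenvector of the map
induced on the quotient. -/
theorem exists_invariant_finrank_eq {E : Type*} [AddCommGroup E] [Module ℂ E]
    [FiniteDimensional ℂ E] (f : E →ₗ[ℂ] E) (d : ℕ) (hd : d ≤ Module.finrank ℂ E) :
    ∃ W : Submodule ℂ E, Module.finrank ℂ W = d ∧ W ≤ W.comap f := by
  induction d with
  | zero => exact ⟨⊥, by simp, bot_le⟩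
  | succ d ih =>
    obtain ⟨W, hW, hf⟩ := ih (by omega)
    have hq : 0 < Module.finrank ℂ (E ⧸ W) := by
      have := W.finrank_quotient_add_finrank
      omega
    have : Nontrivial (E ⧸ W) := Module.finrank_pos_iff.mp hq
    obtain ⟨μ, hμ⟩ := Module.End.exists_eigenvalue (W.mapQ W f hf)
    obtain ⟨x, hx, hx0⟩ := hμ.exists_hasEigenvector
    obtain ⟨v, rfl⟩ := W.mkQ_surjective x
    have hvW : v ∉ W := fun hv => hx0 (by simpa using hv)
    have hfv : f v - μ • v ∈ W := by
      rw [Module.End.mem_eigenspace_iff] at hx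
      rw [← Submodule.Quotient.mk_eq_zero]
      simpa [sub_eq_zero] using hx
    have hlt : W < W ⊔ Submodule.span ℂ {v} := by
      refine lt_of_le_of_ne le_sup_left fun heq => hvW ?_
      rw [heq]
      exact Submodule.mem_sup_right (Submodule.mem_span_singleton_self v)
    have h1 := Submodule.finrank_lt_finrank_of_lt hlt
    have h2 := Submodule.finrank_add_le_finrank_add_finrank W (Submodule.span ℂ {v})
    have h3 : Module.finrank ℂ (Submodule.span ℂ {v}) ≤ 1 := by
      simpa using finrank_span_le_card (R := ℂ) ({v} : Set E)
    refine ⟨W ⊔ Submodule.span ℂ {v}, by omega, sup_le (hf.trans ?_) ?_⟩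
    · exact Submodule.comap_mono le_sup_left
    · rw [Submodule.span_singleton_le_iff_mem, Submodule.mem_comap]
      have : f v = (f v - μ • v) + μ • v := by abel
      rw [this]
      exact add_mem (Submodule.mem_sup_left hfv) (Submodule.mem_sup_right
        (Submodule.smul_mem _ _ (Submodule.mem_span_singleton_self v)))

/-- With invertible channels the two interferers can be made to coincide at every receiver, by V (j
+ 2) = S j (V (j + 1)). Going once around the three users, this asks V 0 to be invariant under S 1 ∘
S 0 ∘ S 2. The interference then has dimension at most d ≤ M - d. -/
theorem generically_alignable_square {M d : ℕ} (hd : 2 * d ≤ M) :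
    Generically fun h : Fin 3 → Fin 3 → Fin M → Fin M → ℂ => Alignable h d (M - d) := by
  refine ⟨fun h => ∏ j : Fin 3, ∏ i : Fin 3, (Matrix.of (h j i)).det,
    differentiable_finsetProd fun j => differentiable_finsetProd fun i =>
      differentiable_det fun r c => ?_, ⟨fun _ _ => (1 : Matrix (Fin M) (Fin M) ℂ), ?_⟩,
    fun h hh => ?_⟩
  · simp only [Matrix.of_apply]; fun_prop
  · exact Finset.prod_ne_zero_iff.mpr fun j _ => Finset.prod_ne_zero_iff.mpr fun i _ =>
      (Matrix.det_one (n := Fin M) (R := ℂ)).trans_ne one_ne_zero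
  have hu : ∀ j i, IsUnit (Matrix.of (h j i)).det := fun j i =>
    isUnit_iff_ne_zero.mpr
      (Finset.prod_ne_zero_iff.mp (Finset.prod_ne_zero_iff.mp hh j (Finset.mem_univ j)) i
        (Finset.mem_univ i))
  let H : Fin 3 → Fin 3 → Matrix (Fin M) (Fin M) ℂ := fun j i => Matrix.of (h j i)
  let S : Fin 3 → Matrix (Fin M) (Fin M) ℂ := fun j => (H j (j + 2))⁻¹ * H j (j + 1)
  have hS : ∀ j v, (H j (j + 2)).mulVec ((S j).mulVec v) = (H j (j + 1)).mulVec v := by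
    intro j v
    rw [Matrix.mulVec_mulVec, ← Matrix.mul_assoc, Matrix.mul_nonsing_inv _ (hu _ _), one_mul]
  have hSi : ∀ j, Function.Injective (S j).mulVecLin := by
    intro j
    rw [Matrix.coe_mulVecLin, Matrix.mulVec_injective_iff_isUnit, Matrix.isUnit_iff_isUnit_det,
      Matrix.det_mul]
    exact (Matrix.isUnit_nonsing_inv_det _ (hu _ _)).mul (hu _ _)
  obtain ⟨W, hW, hinv⟩ := exists_invariant_finrank_eq
    ((S 1).mulVecLin ∘ₗ (S 0).mulVecLin ∘ₗ (S 2).mulVecLin) d (by simp; omega)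
  let W₁ := W.map (S 2).mulVecLin
  let W₂ := W₁.map (S 0).mulVecLin
  have hW₁ : Module.finrank ℂ W₁ = d := by
    rw [← hW]; exact (Submodule.equivMapOfInjective _ (hSi 2) W).finrank_eq.symm
  have hW₂ : Module.finrank ℂ W₂ = d := by
    rw [← hW₁]; exact (Submodule.equivMapOfInjective _ (hSi 0) W₁).finrank_eq.symm
  refine ⟨![W, W₁, W₂], ![W₁.map (H 0 1).mulVecLin, W.map (H 1 0).mulVecLin,
    W.map (H 2 0).mulVecLin], ?_, ?_, ?_⟩
  · intro i
    fin_cases i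
    · exact hW.ge
    · exact hW₁.ge
    · exact hW₂.ge
  · have h0 := Submodule.finrank_map_le (H 0 1).mulVecLin W₁
    have h1 := Submodule.finrank_map_le (H 1 0).mulVecLin W
    have h2 := Submodule.finrank_map_le (H 2 0).mulVecLin W
    intro j
    have hd' : d ≤ M - d := by omega
    fin_cases j
    · exact h0.trans (hW₁.trans_le hd')
    · exact h1.trans (hW.trans_le hd')
    · exact h2.trans (hW.trans_le hd')
  · intro i j hij v hv
    fin_cases i <;> fin_cases j
    · exact absurd rfl hij
    · exact ⟨v, hv, rfl⟩
    · exact ⟨v, hv, rfl⟩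
    · exact ⟨v, hv, rfl⟩
    · exact absurd rfl hij
    · obtain ⟨w, hw, rfl⟩ := hv
      exact ⟨w, hw, (hS 2 w).symm⟩
    · obtain ⟨w, hw, rfl⟩ := hv
      exact ⟨w, hw, (hS 0 w).symm⟩
    · obtain ⟨_, ⟨w, hw, rfl⟩, rfl⟩ := hv
      exact ⟨_, hinv hw, hS 1 _⟩
    · exact absurd rfl hij

/-! ### Zero-forcing filters and the direct channels -/

variable {MT MR d : ℕ}

/-- There are beamforming matrices with left inverses and receive filters with right inverses that
null all interference. -/
def CrossAligned (h : Fin 3 → Fin 3 → Fin MR → Fin MT → ℂ) (d : ℕ) : Prop :=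
  ∃ (V : Fin 3 → Matrix (Fin MT) (Fin d) ℂ) (U : Fin 3 → Matrix (Fin d) (Fin MR) ℂ),
    (∀ i, ∃ L : Matrix (Fin d) (Fin MT) ℂ, L * V i = 1) ∧
    (∀ j, ∃ R : Matrix (Fin MR) (Fin d) ℂ, U j * R = 1) ∧
    ∀ i j, i ≠ j → U j * Matrix.of (h j i) * V i = 0

/-- There are beamforming matrices and receive filters that null all interference and turn the
desired channels into identity matrices. -/
def ZeroForceable (h : Fin 3 → Fin 3 → Fin MR → Fin MT → ℂ) (d : ℕ) : Prop :=
  ∃ (V : Fin 3 → Matrix (Fin MT) (Fin d) ℂ) (U : Fin 3 → Matrix (Fin d) (Fin MR) ℂ),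
    ∀ i j, U j * Matrix.of (h j i) * V i = if i = j then 1 else 0

theorem exists_surjective_of_le_finrank {E : Type*} [AddCommGroup E] [Module ℂ E]
    [FiniteDimensional ℂ E] (hd : d ≤ Module.finrank ℂ E) :
    ∃ π : E →ₗ[ℂ] (Fin d → ℂ), Function.Surjective π :=
  ⟨(LinearMap.funLeft ℂ ℂ (Fin.castLE hd)).comp (Module.finBasis ℂ E).equivFun.toLinearMap,
    (LinearMap.funLeft_surjective_of_injective ℂ ℂ _ (Fin.castLE_injective hd)).comp
      (Module.finBasis ℂ E).equivFun.surjective⟩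

/-- The beamformers parametrize d-dimensional parts of the beam spaces, and the filters factor
through the quotients by the interference spaces, whose dimension is at least d. -/
theorem Alignable.crossAligned {h : Fin 3 → Fin 3 → Fin MR → Fin MT → ℂ} (hd : d ≤ MR)
    (hh : Alignable h d (MR - d)) : CrossAligned h d := by
  obtain ⟨V, I, hV, hI, hVI⟩ := hh
  choose π hπ using fun i => exists_surjective_of_le_finrank (hV i)
  choose ι hι using fun i => (π i).exists_rightInverse_of_surjective
    (LinearMap.range_eq_top.mpr (hπ i))
  have hι' : ∀ i x, π i (ι i x) = x := fun i x => LinearMap.congr_fun (hι i) x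
  have hinj : ∀ i, LinearMap.ker ((V i).subtype.comp (ι i)) = ⊥ := by
    intro i
    rw [LinearMap.ker_eq_bot]
    exact (V i).subtype_injective.comp (Function.LeftInverse.injective (hι' i))
  choose L hL using fun i => ((V i).subtype.comp (ι i)).exists_leftInverse_of_injective (hinj i)
  have hq : ∀ j, d ≤ Module.finrank ℂ ((Fin MR → ℂ) ⧸ I j) := by
    intro j
    have h1 := (I j).finrank_quotient_add_finrank
    have h2 := hI j
    rw [Module.finrank_fin_fun] at h1
    omega
  choose σ hσ using fun j => exists_surjective_of_le_finrank (hq j)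
  choose R hR using fun j => ((σ j).comp (I j).mkQ).exists_rightInverse_of_surjective
    (LinearMap.range_eq_top.mpr ((hσ j).comp (I j).mkQ_surjective))
  refine ⟨fun i => LinearMap.toMatrix' ((V i).subtype.comp (ι i)),
    fun j => LinearMap.toMatrix' ((σ j).comp (I j).mkQ),
    fun i => ⟨LinearMap.toMatrix' (L i), ?_⟩, fun j => ⟨LinearMap.toMatrix' (R j), ?_⟩, ?_⟩
  · rw [← LinearMap.toMatrix'_comp, hL, LinearMap.toMatrix'_id]
  · rw [← LinearMap.toMatrix'_comp, hR, LinearMap.toMatrix'_id]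
  · intro i j hij
    have hM : Matrix.of (h j i) = LinearMap.toMatrix' (Matrix.of (h j i)).mulVecLin :=
      (LinearMap.toMatrix'_toLin' _).symm
    rw [hM, ← LinearMap.toMatrix'_comp,
      ← LinearMap.toMatrix'_comp, LinearEquiv.map_eq_zero_iff]
    ext1 x
    ext1
    have := hVI i j hij (ι i (Pi.single x 1)) (ι i (Pi.single x 1)).2
    have h0 : (I j).mkQ ((Matrix.of (h j i)).mulVec (ι i (Pi.single x 1))) = 0 := by
      simpa using this
    simp only [LinearMap.comp_apply, Matrix.mulVecLin_apply, Submodule.subtype_apply,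
      LinearMap.single_apply, h0, map_zero]
    rfl

/-- Reciprocity: transposing the nulling equations exchanges beamformers with receive filters. -/
theorem CrossAligned.of_transpose {h : Fin 3 → Fin 3 → Fin MR → Fin MT → ℂ}
    (hh : CrossAligned (fun i j c r => h j i r c) d) : CrossAligned h d := by
  obtain ⟨V, U, hV, hU, hUV⟩ := hh
  refine ⟨fun i => (U i).transpose, fun j => (V j).transpose, fun i => ?_, fun j => ?_, ?_⟩
  · obtain ⟨R, hR⟩ := hU i
    exact ⟨R.transpose, by rw [← Matrix.transpose_mul, hR, Matrix.transpose_one]⟩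
  · obtain ⟨L, hL⟩ := hV j
    exact ⟨L.transpose, by rw [← Matrix.transpose_mul, hL, Matrix.transpose_one]⟩
  · intro i j hij
    have := congrArg Matrix.transpose (hUV j i hij.symm)
    rw [Matrix.transpose_mul, Matrix.transpose_mul, ← Matrix.mul_assoc,
      Matrix.transpose_zero] at this
    exact this

theorem Generically.of_transpose
    (hh : Generically fun h : Fin 3 → Fin 3 → Fin MT → Fin MR → ℂ => CrossAligned h d) :
    Generically fun h : Fin 3 → Fin 3 → Fin MR → Fin MT → ℂ => CrossAligned h d := by
  obtain ⟨f, hf, ⟨x, hx⟩, h⟩ := hh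
  refine ⟨fun h => f fun i j c r => h j i r c, hf.comp ?_, ⟨fun j i r c => x i j c r, hx⟩,
    fun y hy => CrossAligned.of_transpose (h _ hy)⟩
  fun_prop

/-- The nulling equations do not involve the direct channels, so `V` and `U` stay fixed while `g`
varies. The determinants are nonzero at `g j = R j * L j`, and inverting `U j * g j * V j`
normalizes the filters. -/
theorem CrossAligned.generically_zeroForceable {h : Fin 3 → Fin 3 → Fin MR → Fin MT → ℂ}
    (hh : CrossAligned h d) : Generically fun g : Fin 3 → Fin MR → Fin MT → ℂ =>
      ZeroForceable (fun j => Function.update (h j) j (g j)) d := by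
  obtain ⟨V, U, hV, hU, hUV⟩ := hh
  choose L hL using hV
  choose R hR using hU
  refine ⟨fun g => ∏ j, (U j * Matrix.of (g j) * V j).det,
    differentiable_finsetProd fun j => differentiable_det fun r c => ?_,
    ⟨fun j => R j * L j, ?_⟩, fun g hg => ?_⟩
  · simp only [Matrix.mul_apply, Matrix.of_apply]
    fun_prop
  · refine Finset.prod_ne_zero_iff.mpr fun j _ => ?_
    have : U j * Matrix.of (R j * L j) * V j = 1 := by
      change U j * (R j * L j) * V j = 1
      rw [← Matrix.mul_assoc, hR, Matrix.one_mul, hL]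
    rw [this, Matrix.det_one]
    exact one_ne_zero
  · have hu : ∀ j, IsUnit (U j * Matrix.of (g j) * V j).det := fun j =>
      isUnit_iff_ne_zero.mpr (Finset.prod_ne_zero_iff.mp hg j (Finset.mem_univ j))
    refine ⟨V, fun j => (U j * Matrix.of (g j) * V j)⁻¹ * U j, fun i j => ?_⟩
    rw [Matrix.mul_assoc, Matrix.mul_assoc, ← Matrix.mul_assoc (U j)]
    split_ifs with hij
    · subst hij
      simp only [Function.update_self]
      rw [Matrix.nonsing_inv_mul _ (hu i)]
    · simp only [Function.update_of_ne hij]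
      rw [hUV i j hij, Matrix.mul_zero]

/-- Needed for Fubini. The set is the projection of a closed set in a finite-dimensional space,
hence σ-compact. -/
theorem measurableSet_zeroForceable :
    MeasurableSet {h : Fin 3 → Fin 3 → Fin MR → Fin MT → ℂ | ZeroForceable h d} := by
  let S : Set ((Fin 3 → Fin 3 → Fin MR → Fin MT → ℂ) ×
      (Fin 3 → Fin MT → Fin d → ℂ) × (Fin 3 → Fin d → Fin MR → ℂ)) :=
    {p | ∀ i j, Matrix.of (p.2.2 j) * Matrix.of (p.1 j i) * Matrix.of (p.2.1 i) =
      if i = j then 1 else 0}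
  have hS : IsClosed S := by
    simp only [S, Set.ofPred_forall]
    refine isClosed_iInter fun i => isClosed_iInter fun j => isClosed_eq ?_ continuous_const
    refine continuous_matrix fun r c => ?_
    simp only [Matrix.mul_apply, Matrix.of_apply]
    fun_prop
  have h1 : IsSigmaCompact (Prod.fst '' S) :=
    (isSigmaCompact_univ.of_isClosed_subset hS (Set.subset_univ S)).image continuous_fst
  have h2 : {h : Fin 3 → Fin 3 → Fin MR → Fin MT → ℂ | ZeroForceable h d} = Prod.fst '' S := by
    ext h
    constructor
    · rintro ⟨V, U, hVU⟩
      exact ⟨(h, V, U), hVU, rfl⟩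
    · rintro ⟨⟨_, V, U⟩, hVU, rfl⟩
      exact ⟨V, U, hVU⟩
  rw [h2]
  have b2 : BorelSpace (Fin MR → Fin MT → ℂ) := inferInstance
  have b3 : BorelSpace (Fin 3 → Fin MR → Fin MT → ℂ) := Pi.borelSpace
  have b4 : BorelSpace (Fin 3 → Fin 3 → Fin MR → Fin MT → ℂ) := Pi.borelSpace
  obtain ⟨K, hK, hKS⟩ := h1
  rw [← hKS]
  exact MeasurableSet.iUnion fun n => (hK n).measurableSet

theorem ae_zeroForceable (ν : Fin 3 → Fin 3 → Fin MR → Fin MT → Measure ℂ)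
    (hprob : ∀ j i r c, IsProbabilityMeasure (ν j i r c))
    (hcont : ∀ j i r c (z : ℂ), ν j i r c {z} = 0)
    (hgen : Generically fun h : Fin 3 → Fin 3 → Fin MR → Fin MT → ℂ => CrossAligned h d) :
    ∀ᵐ h ∂(channelLaw ν), ZeroForceable h d := by
  let μ : Fin 3 → Fin 3 → Measure (Fin MR → Fin MT → ℂ) := fun j i =>
    Measure.pi fun r => Measure.pi fun c => ν j i r c
  have hμ : ∀ j i, AvoidsZeros (μ j i) := fun j i => AvoidsZeros.pi _ fun r => AvoidsZeros.pi _
    fun c => avoidsZeros_of_atomless _ (hcont j i r c)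
  have hlaw : channelLaw ν = Measure.pi fun j => Measure.pi (μ j) := rfl
  have hall : AvoidsZeros (Measure.pi fun j => Measure.pi (μ j)) :=
    AvoidsZeros.pi _ fun j => AvoidsZeros.pi _ (hμ j)
  -- Fresh direct channels are drawn after `h`: for almost every `h` the beams and filters exist,
  -- and they do not depend on the new diagonal. No measurable choice of beams is required.
  have hres := measurePreserving_update_diagonal μ
  rw [hlaw, ← hres.map_eq, ae_map_iff hres.measurable.aemeasurable measurableSet_zeroForceable]
  have hm := hres.measurable (measurableSet_zeroForceable (MT := MT) (MR := MR) (d := d))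
  have hm' : MeasurableSet {p : (Fin 3 → Fin 3 → Fin MR → Fin MT → ℂ) ×
    (Fin 3 → Fin MR → Fin MT → ℂ) |
      ZeroForceable (fun j => Function.update (p.1 j) j (p.2 j)) d} := hm
  rw [Measure.ae_prod_iff_ae_ae hm']
  filter_upwards [hgen.ae hall] with h hh
  exact hh.generically_zeroForceable.ae (AvoidsZeros.pi _ fun j => hμ j j)

/-! ### Arithmetic of `dofStar` -/

theorem dofStar_comm (MT MR : ℕ) : dofStar MT MR = dofStar MR MT := by
  simp only [dofStar, min_comm, max_comm]

theorem two_mul_le_of_le_dofStar_self {M d : ℕ} (hd : (d : ℚ) ≤ dofStar M M) : 2 * d ≤ M := by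
  simp only [dofStar, min_self, max_self, if_true] at hd
  have : (2 * d : ℚ) ≤ M := by linarith
  exact_mod_cast this

/-- For `M < N`, `d ≤ DoF⋆` means `(2 κ - 1) d ≤ κ M` and `(2 κ + 1) d ≤ κ N`; here `κ = r + 1`. -/
theorem exists_chain_of_le_dofStar {M N d : ℕ} (hM : 0 < M) (hMN : M < N)
    (hd : (d : ℚ) ≤ dofStar M N) :
    ∃ r : ℕ, r * (N - M) ≤ M ∧ (2 * r + 1) * d ≤ (r + 1) * M ∧
      (2 * r + 3) * d ≤ (r + 1) * N := by
  have hMq : (0 : ℚ) < M := by exact_mod_cast hM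
  have hNM : (0 : ℚ) < (N : ℚ) - M := by
    have : (M : ℚ) < N := by exact_mod_cast hMN
    linarith
  have hκ : 0 < chainLength M N := Nat.ceil_pos.mpr (div_pos hMq hNM)
  obtain ⟨r, hr⟩ : ∃ r, chainLength M N = r + 1 := ⟨chainLength M N - 1, by omega⟩
  have hlt : (r : ℚ) < (M : ℚ) / ((N : ℚ) - M) := by
    rw [← Nat.lt_ceil]
    change r < chainLength M N
    omega
  rw [lt_div_iff₀ hNM] at hlt
  simp only [dofStar, min_eq_left hMN.le, max_eq_right hMN.le, if_neg hMN.ne, hr, le_min_iff] at hd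
  obtain ⟨h1, h2⟩ := hd
  push_cast at h1 h2
  have hr0 : (0 : ℚ) ≤ r := by positivity
  have e1 : (2 - 1 / ((r : ℚ) + 1)) = (2 * r + 1) / (r + 1) := by field_simp; ring
  have e2 : (2 + 1 / ((r : ℚ) + 1)) = (2 * r + 3) / (r + 1) := by field_simp; ring
  rw [e1, div_div_eq_mul_div, le_div_iff₀ (by positivity)] at h1
  rw [e2, div_div_eq_mul_div, le_div_iff₀ (by positivity)] at h2
  refine ⟨r, ?_, ?_, ?_⟩
  · have : ((r * (N - M) : ℕ) : ℚ) ≤ M := by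
      push_cast [Nat.cast_sub hMN.le]; linarith
    exact_mod_cast this
  · have : (((2 * r + 1) * d : ℕ) : ℚ) ≤ ((r + 1) * M : ℕ) := by push_cast; linarith
    exact_mod_cast this
  · have : (((2 * r + 3) * d : ℕ) : ℚ) ≤ ((r + 1) * N : ℕ) := by push_cast; linarith
    exact_mod_cast this

theorem generically_crossAligned_of_le {M N d : ℕ} (hM : 0 < M) (hMN : M ≤ N)
    (hd : (d : ℚ) ≤ dofStar M N) :
    Generically fun h : Fin 3 → Fin 3 → Fin N → Fin M → ℂ => CrossAligned h d := by
  suffices h : d ≤ N ∧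
      Generically fun h : Fin 3 → Fin 3 → Fin N → Fin M → ℂ => Alignable h d (N - d) by
    obtain ⟨hdN, f, hf, h0, h⟩ := h
    exact ⟨f, hf, h0, fun x hx => (h x hx).crossAligned hdN⟩
  rcases hMN.eq_or_lt with rfl | hlt
  · have h2 := two_mul_le_of_le_dofStar_self hd
    exact ⟨by omega, generically_alignable_square h2⟩
  · obtain ⟨r, h1, h2, h3⟩ := exists_chain_of_le_dofStar hM hlt hd
    have hdM : d ≤ M := by
      by_contra hcon
      have : (2 * r + 1) * (M + 1) ≤ (2 * r + 1) * d := Nat.mul_le_mul_left _ (by omega)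
      nlinarith
    -- For a = d and b = N - d, the chain inequalities rearrange to the two bounds on d and the
    -- bound on r just obtained.
    refine ⟨by omega, generically_alignable r hMN hdM ?_ ?_ ?_⟩
    · zify at h2
      rw [Nat.cast_sub (by omega)]
      linarith
    · zify at h3
      rw [Nat.cast_sub (by omega)]
      linarith
    · zify [hMN] at h1
      linarith

theorem generically_crossAligned {MT MR d : ℕ} (hMT : 0 < MT) (hMR : 0 < MR)
    (hd : (d : ℚ) ≤ dofStar MT MR) :
    Generically fun h : Fin 3 → Fin 3 → Fin MR → Fin MT → ℂ => CrossAligned h d := by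
  rcases le_total MT MR with h | h
  · exact generically_crossAligned_of_le hMT h hd
  · exact Generically.of_transpose
      (generically_crossAligned_of_le hMR h (by rwa [dofStar_comm]))

theorem dofStar_nonneg (MT MR : ℕ) : 0 ≤ dofStar MT MR := by
  have h : ∀ κ : ℕ, (0 : ℚ) ≤ 2 - 1 / (κ : ℚ) := by
    intro κ
    rcases Nat.eq_zero_or_pos κ with rfl | hκ
    -- Here `1 / 0 = 0`, so the difference is 2.
    · simp
    · have : (1 : ℚ) / κ ≤ 1 := by
        rw [div_le_one (by exact_mod_cast hκ)]
        exact_mod_cast hκ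
      linarith
  simp only [dofStar]
  split_ifs
  · positivity
  · exact le_min (div_nonneg (by positivity) (h _)) (by positivity)

/-! ### Codes in Hamming space and counts of bad channel uses -/

/-- A word in the ball is determined by the set of positions where it differs from `x`, one of at
most `2 ^ n` sets, and by at most `m` letters there. -/
theorem card_hammingBall_le {n : ℕ} {A : Type*} [Fintype A] [DecidableEq A] [Nonempty A]
    (x : Fin n → A) (m : ℕ) :
    (Finset.univ.filter fun y => hammingDist x y ≤ m).card ≤ 2 ^ n * Fintype.card A ^ m := by
  classical
  let T : Finset (Finset (Fin n)) := Finset.univ.filter fun S => S.card ≤ m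
  let F : Finset (Fin n) → Finset (Fin n → A) := fun S =>
    Fintype.piFinset fun i => if i ∈ S then Finset.univ else {x i}
  have hsub : (Finset.univ.filter fun y => hammingDist x y ≤ m) ⊆ T.biUnion F := by
    intro y hy
    simp only [Finset.mem_filter, Finset.mem_univ, true_and] at hy
    refine Finset.mem_biUnion.mpr ⟨Finset.univ.filter fun i => x i ≠ y i,
      Finset.mem_filter.mpr ⟨Finset.mem_univ _, hy⟩, ?_⟩
    refine Fintype.mem_piFinset.mpr fun i => ?_
    by_cases h : x i = y i <;> simp [h]
  have hF : ∀ S ∈ T, (F S).card ≤ Fintype.card A ^ m := by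
    intro S hS
    have hS' : S.card ≤ m := by simpa [T] using hS
    rw [Fintype.card_piFinset]
    have : ∀ i, (if i ∈ S then Finset.univ else {x i} : Finset A).card =
        if i ∈ S then Fintype.card A else 1 := by
      intro i; split_ifs <;> simp
    simp only [this, Finset.prod_ite_mem, Finset.univ_inter, Finset.prod_const]
    exact Nat.pow_le_pow_right Fintype.card_pos hS'
  refine (Finset.card_le_card hsub).trans ((Finset.card_biUnion_le_card_mul _ _ _ hF).trans ?_)
  refine Nat.mul_le_mul_right _ ?_
  calc T.card ≤ (Finset.univ : Finset (Finset (Fin n))).card := Finset.card_le_univ _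
    _ = 2 ^ n := by simp

/-- The Gilbert–Varshamov bound, with a crude estimate of the volume of a Hamming ball. -/
theorem exists_code_hammingDist_gt (n : ℕ) (A : Type*) [Fintype A] [DecidableEq A] [Nonempty A]
    (m : ℕ) : ∃ s : Finset (Fin n → A), (∀ x ∈ s, ∀ y ∈ s, hammingDist x y ≤ m → x = y) ∧
      Fintype.card A ^ n ≤ s.card * (2 ^ n * Fintype.card A ^ m) := by
  classical
  let P : Finset (Finset (Fin n → A)) :=
    Finset.univ.filter fun s => ∀ x ∈ s, ∀ y ∈ s, hammingDist x y ≤ m → x = y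
  obtain ⟨s, hs, hmax⟩ := P.exists_max_image Finset.card ⟨∅, by simp [P]⟩
  have hs' : ∀ x ∈ s, ∀ y ∈ s, hammingDist x y ≤ m → x = y := by simpa [P] using hs
  refine ⟨s, hs', ?_⟩
  -- The balls around a code of maximal size cover the space, since an uncovered word could be
  -- added.
  have hcov : (Finset.univ : Finset (Fin n → A)) ⊆
      s.biUnion fun x => Finset.univ.filter fun y => hammingDist x y ≤ m := by
    intro y _
    by_contra hy
    have hy' : ∀ x ∈ s, ¬ hammingDist x y ≤ m := by simpa using hy
    have hys : y ∉ s := fun h => hy' y h (by simp)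
    have hin : insert y s ∈ P := by
      simp only [P, Finset.mem_filter, Finset.mem_univ, true_and, Finset.mem_insert]
      rintro a (rfl | ha) b (rfl | hb) hab
      · rfl
      · exact absurd (hammingDist_comm a b ▸ hab) (hy' b hb)
      · exact absurd hab (hy' a ha)
      · exact hs' a ha b hb hab
    have := hmax _ hin
    rw [Finset.card_insert_of_notMem hys] at this
    omega
  have h1 := Finset.card_le_card hcov
  rw [Finset.card_univ, Fintype.card_fun, Fintype.card_fin] at h1
  exact h1.trans (Finset.card_biUnion_le_card_mul _ _ _ fun x _ => card_hammingBall_le x m)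

/-- At least `k` of `n` independent events of probability at most `p` occur with probability at most
`2 ^ n * p ^ k`. -/
theorem measure_pi_le_card_filter_le {Ω : Type*} [MeasurableSpace Ω] (μ : Measure Ω)
    [IsProbabilityMeasure μ] (B : Set Ω) (n k : ℕ) :
    open scoped Classical in
    (Measure.pi fun _ : Fin n => μ) {z | k ≤ (Finset.univ.filter fun t => z t ∈ B).card} ≤
      2 ^ n * μ B ^ k := by
  classical
  have hsub : {z : Fin n → Ω | k ≤ (Finset.univ.filter fun t => z t ∈ B).card} ⊆
      ⋃ S ∈ (Finset.univ : Finset (Fin n)).powersetCard k,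
        Set.univ.pi fun t => if t ∈ S then B else Set.univ := by
    intro z hz
    obtain ⟨S, hS, hSk⟩ := Finset.exists_subset_card_eq hz
    refine Set.mem_biUnion (x := S) (by simp [Finset.mem_powersetCard, hSk]) fun t _ => ?_
    by_cases ht : t ∈ S
    · simpa [ht] using (Finset.mem_filter.mp (hS ht)).2
    · simp [ht]
  refine (measure_mono hsub).trans ((measure_biUnion_finset_le _ _).trans ?_)
  have hval : ∀ S ∈ (Finset.univ : Finset (Fin n)).powersetCard k,
      (Measure.pi fun _ : Fin n => μ) (Set.univ.pi fun t => if t ∈ S then B else Set.univ) =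
        μ B ^ k := by
    intro S hS
    rw [Measure.pi_pi]
    have : ∀ t, μ (if t ∈ S then B else Set.univ) = if t ∈ S then μ B else 1 := by
      intro t; split_ifs <;> simp
    simp [this, Finset.prod_ite_mem, (Finset.mem_powersetCard.mp hS).2]
  rw [Finset.sum_congr rfl hval, Finset.sum_const, nsmul_eq_mul, Finset.card_powersetCard,
    Finset.card_univ, Fintype.card_fin]
  gcongr
  exact_mod_cast Nat.choose_le_two_pow n k

instance : IsProbabilityMeasure complexGaussian :=
  Measure.isProbabilityMeasure_map (by fun_prop)

/-- The law of the noise at one receiver in one channel use. -/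
noncomputable abbrev antennaNoise (MR : ℕ) : Measure (Fin MR → ℂ) :=
  Measure.pi fun _ => complexGaussian

theorem noiseLaw_le_card_filter_le {MR n k : ℕ} (B : Set (Fin MR → ℂ)) (hB : MeasurableSet B)
    (j : Fin 3) :
    open scoped Classical in
    noiseLaw MR n {z | k ≤ (Finset.univ.filter fun t => z j t ∈ B).card} ≤
      2 ^ n * antennaNoise MR B ^ k := by
  classical
  have h := measure_pi_le_card_filter_le (antennaNoise MR) B n k
  have hev := measurePreserving_eval
    (fun _ : Fin 3 => Measure.pi fun _ : Fin n => antennaNoise MR) j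
  have hmeas : MeasurableSet {z : Fin n → Fin MR → ℂ |
      k ≤ (Finset.univ.filter fun t => z t ∈ B).card} := by
    have : Measurable fun z : Fin n → Fin MR → ℂ =>
        (Finset.univ.filter fun t => z t ∈ B).card := by
      simp only [Finset.card_filter]
      refine Finset.measurable_sum _ fun t _ => ?_
      exact Measurable.ite (measurable_pi_apply t hB) measurable_const measurable_const
    exact this measurableSet_Ici
  rw [← hev.measure_preimage hmeas.nullMeasurableSet] at h
  exact h

/-! ### Square constellations with hard decisions -/

/-- The point of the square constellation with spacing `Δ` that is labelled by `a`. -/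
noncomputable def qamPoint (Δ : ℝ) (a : ℤ × ℤ) : ℂ := ⟨Δ * a.1, Δ * a.2⟩

/-- The label of a point of the square lattice with spacing `Δ` that is nearest to `u`. -/
noncomputable def qamSlice (Δ : ℝ) (u : ℂ) : ℤ × ℤ := (round (u.re / Δ), round (u.im / Δ))

theorem measurable_qamSlice (Δ : ℝ) : Measurable (qamSlice Δ) := by
  have : qamSlice Δ = fun u => (⌊u.re / Δ + 1 / 2⌋, ⌊u.im / Δ + 1 / 2⌋) := by
    funext u
    rw [qamSlice, round_eq, round_eq]
  rw [this]
  exact (((Complex.measurable_re.div_const Δ).add_const _).floor).prodMk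
    (((Complex.measurable_im.div_const Δ).add_const _).floor)

theorem round_intCast_add_of_abs_lt {a : ℤ} {x : ℝ} (hx : |x| < 1 / 2) : round (a + x) = a := by
  rw [round_intCast_add, round_eq_zero_iff.mpr, add_zero]
  rw [abs_lt] at hx
  exact ⟨by linarith, hx.2⟩

theorem qamSlice_qamPoint_add {Δ : ℝ} (hΔ : 0 < Δ) (a : ℤ × ℤ) {w : ℂ} (hw : ‖w‖ < Δ / 2) :
    qamSlice Δ (qamPoint Δ a + w) = a := by
  have key : ∀ (b : ℤ) (x : ℝ), |x| ≤ ‖w‖ → round ((Δ * b + x) / Δ) = b := by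
    intro b x hx
    rw [add_div, mul_div_cancel_left₀ _ hΔ.ne']
    refine round_intCast_add_of_abs_lt ?_
    rw [abs_div, abs_of_pos hΔ, div_lt_iff₀ hΔ]
    linarith
  exact Prod.ext (key a.1 w.re (Complex.abs_re_le_norm w)) (key a.2 w.im (Complex.abs_im_le_norm w))

theorem norm_qamPoint_le {Δ : ℝ} (hΔ : 0 < Δ) {q : ℕ} (a : Fin q × Fin q) :
    ‖qamPoint Δ ((a.1 : ℕ), (a.2 : ℕ))‖ ≤ 2 * (q * Δ) := by
  have key : ∀ b : Fin q, |Δ * ((b : ℕ) : ℝ)| ≤ q * Δ := by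
    intro b
    rw [abs_of_nonneg (by positivity), mul_comm]
    have : ((b : ℕ) : ℝ) ≤ q := by exact_mod_cast b.2.le
    gcongr
  have h1 := key a.1
  have h2 := key a.2
  refine (Complex.norm_le_abs_re_add_abs_im _).trans ?_
  simp only [qamPoint, Int.cast_natCast]
  linarith

theorem exists_power_bound (V : Fin 3 → Matrix (Fin MT) (Fin d) ℂ) :
    ∃ C : ℝ, 0 < C ∧ ∀ k (s : Fin d → ℂ) (A : ℝ), (∀ m, ‖s m‖ ≤ A) →
      ∑ a, ‖(V k).mulVec s a‖ ^ 2 ≤ C * A ^ 2 := by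
  -- The summand 1 only makes the constant positive, as later divisions require.
  refine ⟨1 + ∑ k, ∑ a, (∑ m, ‖V k a m‖) ^ 2, by positivity, fun k s A hs => ?_⟩
  have h1 : ∀ a, ‖(V k).mulVec s a‖ ≤ (∑ m, ‖V k a m‖) * A := by
    intro a
    change ‖∑ m, V k a m * s m‖ ≤ _
    refine (norm_sum_le _ _).trans ?_
    rw [Finset.sum_mul]
    refine Finset.sum_le_sum fun m _ => ?_
    rw [norm_mul]
    exact mul_le_mul_of_nonneg_left (hs m) (norm_nonneg _)
  have h2 : ∑ a, ‖(V k).mulVec s a‖ ^ 2 ≤ (∑ a, (∑ m, ‖V k a m‖) ^ 2) * A ^ 2 := by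
    rw [Finset.sum_mul]
    refine Finset.sum_le_sum fun a _ => ?_
    rw [← mul_pow]
    exact pow_le_pow_left₀ (norm_nonneg _) (h1 a) 2
  have h3 : ∑ a, (∑ m, ‖V k a m‖) ^ 2 ≤ ∑ k, ∑ a, (∑ m, ‖V k a m‖) ^ 2 :=
    Finset.single_le_sum (f := fun k => ∑ a, (∑ m, ‖V k a m‖) ^ 2)
      (fun _ _ => by positivity) (Finset.mem_univ k)
  refine h2.trans (mul_le_mul_of_nonneg_right ?_ (sq_nonneg A))
  linarith

/-- The noise vectors that the filter `U` maps to a vector with an entry of norm at least `r`. -/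
def largeNoise (U : Matrix (Fin d) (Fin MR) ℂ) (r : ℝ) : Set (Fin MR → ℂ) :=
  {z | ∃ m, r ≤ ‖U.mulVec z m‖}

theorem measurableSet_largeNoise (U : Matrix (Fin d) (Fin MR) ℂ) (r : ℝ) :
    MeasurableSet (largeNoise U r) := by
  have : largeNoise U r = ⋃ m, {z | r ≤ ‖U.mulVec z m‖} := by
    ext; simp [largeNoise]
  rw [this]
  refine MeasurableSet.iUnion fun m => (isClosed_le continuous_const ?_).measurableSet
  simp only [Matrix.mulVec, dotProduct]
  fun_prop

namespace Code

/-- A bound on the power of every transmitted vector bounds the average power. -/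
theorem avgPower_le {n : ℕ} (c : Code MT MR n) {ρ : ℝ} (hρ : 0 ≤ ρ) (k : Fin 3)
    (h : ∀ w t, ∑ a, ‖c.enc k w t a‖ ^ 2 ≤ ρ) : c.avgPower k ≤ ρ := by
  have h1 : ∀ w, (∑ t, ∑ a, ‖c.enc k w t a‖ ^ 2) / (n : ℝ) ≤ ρ := by
    intro w
    refine div_le_of_le_mul₀ (by positivity) hρ ?_
    calc ∑ t, ∑ a, ‖c.enc k w t a‖ ^ 2 ≤ ∑ _t : Fin n, ρ := Finset.sum_le_sum fun t _ => h w t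
      _ = ρ * n := by simp [mul_comm]
  refine div_le_of_le_mul₀ (by positivity) hρ ?_
  calc ∑ w, (∑ t, ∑ a, ‖c.enc k w t a‖ ^ 2) / (n : ℝ) ≤ ∑ _w : Fin (c.size k), ρ :=
        Finset.sum_le_sum fun w _ => h1 w
    _ = ρ * c.size k := by simp [mul_comm]

theorem errorProb_le {n : ℕ} (c : Code MT MR n) (H : Channel MT MR) {ε : ℝ} (hε : 0 ≤ ε)
    (h : ∀ w, (noiseLaw MR n).real {z | ∃ j, c.dec j (c.received H w z j) ≠ w j} ≤ ε) :
    c.errorProb H ≤ ε := by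
  refine div_le_of_le_mul₀ (by positivity) hε ?_
  calc _ ≤ ∑ _w : (k : Fin 3) → Fin (c.size k), ε := Finset.sum_le_sum fun w _ => h w
    _ = ε * ∏ k, (c.size k : ℝ) := by
      simp [Fintype.card_pi, mul_comm]

end Code

/-- Bounded-distance decoding of a code with minimum distance above `2 * k` corrects `k` errors. -/
theorem exists_decoder {n k : ℕ} {A B : Type*} [DecidableEq B] [DecidableEq A] (e : A → B)
    (he : Function.Injective e) {N : ℕ} (hN : 0 < N) (word : Fin N → Fin n → A)
    (hw : ∀ w w', hammingDist (word w) (word w') ≤ 2 * k → w = w') :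
    ∃ D : (Fin n → B) → Fin N, ∀ r w,
      hammingDist r (fun t => e (word w t)) ≤ k → D r = w := by
  classical
  refine ⟨fun r => if h : ∃ w, hammingDist r (fun t => e (word w t)) ≤ k then h.choose
    else ⟨0, hN⟩, fun r w hr => ?_⟩
  have h : ∃ w, hammingDist r (fun t => e (word w t)) ≤ k := ⟨w, hr⟩
  simp only [dif_pos h]
  refine hw _ _ ?_
  have h1 := hammingDist_triangle_left (fun t => e (word h.choose t)) (fun t => e (word w t)) r
  have h2 : hammingDist (fun t => e (word h.choose t)) (fun t => e (word w t)) =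
      hammingDist (word h.choose) (word w) :=
    hammingDist_comp (fun _ => e) (fun _ => he)
  have h3 := h.choose_spec
  omega

instance (n : ℕ) : IsProbabilityMeasure (noiseLaw MR n) := by
  unfold noiseLaw; infer_instance

/-- A union bound over the receivers. The entries of the filtered noise within one channel use may
be dependent; only independence across channel uses matters. -/
theorem noiseLaw_real_decoding_error_le {n k : ℕ} (U : Fin 3 → Matrix (Fin d) (Fin MR) ℂ) {r p : ℝ}
    (hp : 0 ≤ p) (hU : ∀ j, (antennaNoise MR).real (largeNoise (U j) r) ≤ p) :
    open scoped Classical in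
    (noiseLaw MR n).real {z | ∃ j,
      k ≤ (Finset.univ.filter fun t => z j t ∈ largeNoise (U j) r).card} ≤ 3 * 2 ^ n * p ^ k := by
  classical
  have hset : {z : Fin 3 → Fin n → Fin MR → ℂ | ∃ j,
      k ≤ (Finset.univ.filter fun t => z j t ∈ largeNoise (U j) r).card} =
      ⋃ j, {z | k ≤ (Finset.univ.filter fun t => z j t ∈ largeNoise (U j) r).card} := by
    ext; simp
  have hj : ∀ j, noiseLaw MR n {z | k ≤ (Finset.univ.filter fun t =>
      z j t ∈ largeNoise (U j) r).card} ≤ 2 ^ n * ENNReal.ofReal p ^ k := by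
    intro j
    refine (noiseLaw_le_card_filter_le _ (measurableSet_largeNoise (U j) r) j).trans ?_
    gcongr
    rw [← ENNReal.ofReal_toReal (measure_ne_top (antennaNoise MR) (largeNoise (U j) r))]
    exact ENNReal.ofReal_le_ofReal (hU j)
  have h1 : noiseLaw MR n {z | ∃ j, k ≤ (Finset.univ.filter fun t =>
      z j t ∈ largeNoise (U j) r).card} ≤ ENNReal.ofReal (3 * 2 ^ n * p ^ k) := by
    rw [hset]
    refine (measure_iUnion_fintype_le _ _).trans ((Finset.sum_le_sum fun j _ => hj j).trans ?_)
    rw [Finset.sum_const, Finset.card_univ, Fintype.card_fin, nsmul_eq_mul,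
      ENNReal.ofReal_mul (by positivity), ENNReal.ofReal_mul (by positivity),
      ENNReal.ofReal_pow hp, ENNReal.ofReal_pow (by norm_num), mul_assoc]
    simp
  exact ENNReal.toReal_le_of_le_ofReal (by positivity) h1

/-- Codes with hard decisions on a square constellation: the alphabet of each stream has `q ^ 2`
points with spacing `Δ`, and the outer code has minimum distance above `2 * k`. -/
theorem exists_code {H : Channel MT MR} {V : Fin 3 → Matrix (Fin MT) (Fin d) ℂ}
    {U : Fin 3 → Matrix (Fin d) (Fin MR) ℂ}
    (hUV : ∀ i j, U j * H j i * V i = if i = j then 1 else 0) {C ρ Δ p : ℝ}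
    (hC : ∀ k (s : Fin d → ℂ) (A : ℝ), (∀ m, ‖s m‖ ≤ A) →
      ∑ a, ‖(V k).mulVec s a‖ ^ 2 ≤ C * A ^ 2)
    (hρ : 0 ≤ ρ) (hΔ : 0 < Δ) (hp : 0 ≤ p)
    (hU : ∀ j, (antennaNoise MR).real (largeNoise (U j) (Δ / 2)) ≤ p) {q : ℕ} (hq : 0 < q)
    (hpow : C * (2 * (q * Δ)) ^ 2 ≤ ρ) (n k : ℕ) :
    ∃ c : Code MT MR n, c.IsLinear V U ∧ (∀ i, c.avgPower i ≤ ρ) ∧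
      (∀ i, (q ^ (2 * d)) ^ n ≤ c.size i * (2 ^ n * (q ^ (2 * d)) ^ (2 * k))) ∧
      c.errorProb H ≤ 3 * 2 ^ n * p ^ k := by
  classical
  have : NeZero q := ⟨hq.ne'⟩
  let A := Fin d → Fin q × Fin q
  have hA : Fintype.card A = q ^ (2 * d) := by
    simp only [A, Fintype.card_fun, Fintype.card_prod, Fintype.card_fin]
    rw [← pow_two, ← pow_mul]
  obtain ⟨S, hS, hcard⟩ := exists_code_hammingDist_gt n A (2 * k)
  rw [hA] at hcard
  have hSpos : 0 < S.card := by
    have h1 : 0 < (q ^ (2 * d)) ^ n := by positivity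
    by_contra hcon
    rw [Nat.eq_zero_of_not_pos hcon, zero_mul] at hcard
    omega
  let word : Fin S.card → Fin n → A := fun w => (S.equivFin.symm w : Fin n → A)
  have hword : ∀ w w', hammingDist (word w) (word w') ≤ 2 * k → w = w' := fun w w' h =>
    S.equivFin.symm.injective (Subtype.ext (hS _ (S.equivFin.symm w).2 _ (S.equivFin.symm w').2 h))
  -- The slicer may return lattice labels outside the constellation, so decoding works over all
  -- labels, into which the alphabet embeds.
  let label : A → Fin d → ℤ × ℤ := fun a m => (((a m).1 : ℕ), ((a m).2 : ℕ))
  have hlabel : Function.Injective label := by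
    intro a b hab
    funext m
    have h := congrFun hab m
    simp only [label, Prod.mk.injEq, Nat.cast_inj] at h
    exact Prod.ext (Fin.ext h.1) (Fin.ext h.2)
  obtain ⟨D, hD⟩ := exists_decoder label hlabel hSpos word hword
  let sym : A → Fin d → ℂ := fun a m => qamPoint Δ (label a m)
  let slice : (Fin d → ℂ) → Fin d → ℤ × ℤ := fun u m => qamSlice Δ (u m)
  have hslice : Measurable slice := measurable_pi_iff.mpr fun m =>
    (measurable_qamSlice Δ).comp (measurable_pi_apply m)
  let c : Code MT MR n :=
    { size := fun _ => S.card
      enc := fun i w t => (V i).mulVec (sym (word w t))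
      dec := fun j y => D fun t => slice ((U j).mulVec (y t))
      measurable_dec := fun j => by
        refine (Measurable.of_discrete (f := D)).comp (measurable_pi_iff.mpr fun t => ?_)
        refine hslice.comp ?_
        have : Continuous fun y : Fin n → Fin MR → ℂ => (U j).mulVec (y t) := by fun_prop
        exact this.measurable }
  refine ⟨c, ⟨fun i w t => ⟨_, rfl⟩, fun j => ⟨fun u => D fun t => slice (u t), fun y => rfl⟩⟩,
    fun i => c.avgPower_le hρ i fun w t => ?_, fun i => hcard, ?_⟩
  · exact (hC i _ _ fun m => norm_qamPoint_le hΔ _).trans hpow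
  · refine c.errorProb_le H (by positivity) fun w => ?_
    refine le_trans (measureReal_mono ?_) (noiseLaw_real_decoding_error_le (k := k) U hp hU)
    rintro z ⟨j, hj⟩
    refine ⟨j, ?_⟩
    by_contra hcon
    push Not at hcon
    -- A symbol is sliced wrongly only when the filtered noise is large, so fewer than `k` such
    -- times leave the received word within the decoding radius.
    refine hj (hD _ _ (le_trans (Finset.card_le_card ?_) hcon.le))
    intro t ht
    simp only [Finset.mem_filter, Finset.mem_univ, true_and] at ht ⊢
    by_contra hgood
    refine ht ?_
    have hrec : (U j).mulVec (c.received H w z j t) =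
        sym (word (w j) t) + (U j).mulVec (z j t) := by
      simp only [Code.received, c, Matrix.mulVec_add, Matrix.mulVec_sum]
      congr 1
      rw [Finset.sum_eq_single j]
      · rw [Matrix.mulVec_mulVec, Matrix.mulVec_mulVec, hUV j j, if_pos rfl,
          Matrix.one_mulVec]
      · intro i _ hij
        rw [Matrix.mulVec_mulVec, Matrix.mulVec_mulVec, hUV i j, if_neg hij,
          Matrix.zero_mulVec]
      · simp
    rw [hrec]
    funext m
    have hm : ‖(U j).mulVec (z j t) m‖ < Δ / 2 := by
      by_contra hcon
      exact hgood ⟨m, not_lt.mp hcon⟩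
    exact qamSlice_qamPoint_add hΔ _ hm

theorem linearlyAchievable_zero (H : Channel MT MR) (V : Fin 3 → Matrix (Fin MT) (Fin d) ℂ)
    (U : Fin 3 → Matrix (Fin d) (Fin MR) ℂ) {ρ : ℝ} (hρ : 0 ≤ ρ) :
    LinearlyAchievable H V U ρ fun _ => 0 := by
  refine fun ε hε => Eventually.of_forall fun n => ?_
  let c : Code MT MR n :=
    { size := fun _ => 1
      enc := fun _ _ _ => 0
      dec := fun _ _ => 0
      measurable_dec := fun _ => measurable_const }
  refine ⟨c, ⟨fun i w t => ⟨0, by simp [c]⟩, fun j => ⟨fun _ => 0, fun _ => rfl⟩⟩,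
    fun i => c.avgPower_le hρ i fun w t => by simp [c, hρ], fun i => by simp [c],
    c.errorProb_le H hε.le fun w => ?_⟩
  have : {z | ∃ j, c.dec j (c.received H w z j) ≠ w j} = ∅ := by
    ext z
    simp only [Set.mem_ofPred_eq, Set.mem_empty_iff_false, iff_false, not_exists, not_not]
    exact fun j => Subsingleton.elim (α := Fin 1) _ _
  rw [this, measureReal_empty]
  exact hε.le

/-- Of the loss of 2 nats, one pays for the factor `2 ^ n ≤ exp n`, the other for rounding `k` up,
which costs 2ℓ ≤ n in the exponent. -/
theorem exp_le_of_codeSize {ℓ τ : ℝ} {N n k : ℕ} (hℓ : 0 ≤ ℓ) (hn : 2 * ℓ ≤ n)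
    (hk : (k : ℝ) ≤ τ * n + 1)
    (h : Real.exp ℓ ^ n ≤ N * (2 ^ n * Real.exp ℓ ^ (2 * k))) :
    Real.exp (n * ((1 - 2 * τ) * ℓ - 2)) ≤ N := by
  have h2 : (2 : ℝ) ^ n ≤ Real.exp n := by
    have : (2 : ℝ) ≤ Real.exp 1 := by
      have := Real.add_one_le_exp (1 : ℝ)
      linarith
    calc (2 : ℝ) ^ n ≤ Real.exp 1 ^ n := pow_le_pow_left₀ (by norm_num) this n
      _ = Real.exp n := by rw [← Real.exp_nat_mul, mul_one]
  have h3 : Real.exp ℓ ^ n ≤ N * (Real.exp n * Real.exp ℓ ^ (2 * k)) :=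
    h.trans (by gcongr)
  rw [← Real.exp_nat_mul, ← Real.exp_nat_mul, ← Real.exp_add] at h3
  have h4 : (k : ℝ) * ℓ ≤ (τ * n + 1) * ℓ := mul_le_mul_of_nonneg_right hk hℓ
  have h5 : Real.exp (n * ((1 - 2 * τ) * ℓ - 2)) * Real.exp (n + (2 * k : ℕ) * ℓ) ≤
      N * Real.exp (n + (2 * k : ℕ) * ℓ) := by
    rw [← Real.exp_add]
    refine le_trans (Real.exp_le_exp.mpr ?_) h3
    push_cast
    nlinarith
  exact le_of_mul_le_mul_right h5 (Real.exp_pos _)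

/-- Correcting a fraction τ of symbol errors costs a fraction 2τ of the rate, and `p ^ τ ≤ 1 / 4`
beats the `2 ^ n` choices of error positions. -/
theorem linearlyAchievable_of_qam {H : Channel MT MR} {V : Fin 3 → Matrix (Fin MT) (Fin d) ℂ}
    {U : Fin 3 → Matrix (Fin d) (Fin MR) ℂ}
    (hUV : ∀ i j, U j * H j i * V i = if i = j then 1 else 0) {C ρ Δ p τ : ℝ}
    (hC : ∀ k (s : Fin d → ℂ) (A : ℝ), (∀ m, ‖s m‖ ≤ A) →
      ∑ a, ‖(V k).mulVec s a‖ ^ 2 ≤ C * A ^ 2)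
    (hρ : 0 ≤ ρ) (hΔ : 0 < Δ) (hp : 0 < p) (hp1 : p ≤ 1)
    (hU : ∀ j, (antennaNoise MR).real (largeNoise (U j) (Δ / 2)) ≤ p) {q : ℕ} (hq : 0 < q)
    (hpow : C * (2 * (q * Δ)) ^ 2 ≤ ρ) (hτ : 0 ≤ τ) (hpτ : p ^ τ ≤ 1 / 4) :
    LinearlyAchievable H V U ρ fun _ => (1 - 2 * τ) * (2 * d * Real.log q) - 2 := by
  intro ε hε
  have hq1 : (1 : ℝ) ≤ q := by exact_mod_cast hq
  have hlim : Tendsto (fun n : ℕ => 3 * (1 / 2 : ℝ) ^ n) atTop (𝓝 0) := by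
    simpa using (tendsto_pow_atTop_nhds_zero_of_lt_one (r := (1 / 2 : ℝ)) (by norm_num)
      (by norm_num)).const_mul 3
  filter_upwards [hlim.eventually_le_const hε,
    (tendsto_natCast_atTop_atTop (R := ℝ)).eventually_ge_atTop (2 * (2 * d * Real.log q))]
    with n hn1 hn2
  obtain ⟨c, hlin, hpw, hsize, herr⟩ := exists_code hUV hC hρ hΔ hp.le hU hq hpow n ⌈τ * n⌉₊
  refine ⟨c, hlin, hpw, fun i => ?_, herr.trans (le_trans ?_ hn1)⟩
  · refine exp_le_of_codeSize (k := ⌈τ * n⌉₊)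
      (mul_nonneg (by positivity) (Real.log_nonneg hq1)) hn2
      (Nat.ceil_lt_add_one (by positivity)).le ?_
    have he : Real.exp (2 * d * Real.log q) = (q : ℝ) ^ (2 * d) := by
      rw [show (2 * d * Real.log q : ℝ) = ((2 * d : ℕ) : ℝ) * Real.log q by push_cast; ring,
        Real.exp_nat_mul, Real.exp_log (by linarith)]
    rw [he]
    exact_mod_cast hsize i
  · have h1 : p ^ ⌈τ * n⌉₊ ≤ (1 / 4 : ℝ) ^ n := by
      calc p ^ ⌈τ * n⌉₊ = p ^ ((⌈τ * n⌉₊ : ℕ) : ℝ) := (Real.rpow_natCast _ _).symm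
        _ ≤ p ^ (τ * n) := Real.rpow_le_rpow_of_exponent_ge hp hp1 (Nat.le_ceil _)
        _ = (p ^ τ) ^ n := by rw [Real.rpow_mul hp.le, Real.rpow_natCast]
        _ ≤ (1 / 4 : ℝ) ^ n := pow_le_pow_left₀ (Real.rpow_nonneg hp.le _) hpτ n
    calc 3 * 2 ^ n * p ^ ⌈τ * n⌉₊ ≤ 3 * 2 ^ n * (1 / 4 : ℝ) ^ n := by gcongr
      _ = 3 * (1 / 2 : ℝ) ^ n := by rw [mul_assoc, ← mul_pow]; norm_num

/-! ### Asymptotics at high power -/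

/-- Continuity from above; no rate of decay of the Gaussian tail is needed. -/
theorem tendsto_measure_largeNoise (U : Matrix (Fin d) (Fin MR) ℂ) :
    Tendsto (fun r => (antennaNoise MR).real (largeNoise U r)) atTop (𝓝 0) := by
  have hanti : Antitone (largeNoise U) := fun r s hrs z ⟨m, hm⟩ => ⟨m, hrs.trans hm⟩
  have h := tendsto_measure_iInter_atTop (μ := antennaNoise MR) (s := largeNoise U)
    (fun r => (measurableSet_largeNoise U r).nullMeasurableSet) hanti ⟨0, measure_ne_top _ _⟩
  have hempty : ⋂ r, largeNoise U r = ∅ := by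
    rw [Set.eq_empty_iff_forall_notMem]
    intro z hz
    rw [Set.mem_iInter] at hz
    obtain ⟨m, hm⟩ := hz (1 + ∑ m, ‖U.mulVec z m‖)
    have := Finset.single_le_sum (f := fun m => ‖U.mulVec z m‖) (fun _ _ => norm_nonneg _)
      (Finset.mem_univ m)
    linarith
  rw [hempty, measure_empty] at h
  exact (ENNReal.tendsto_toReal ENNReal.zero_ne_top).comp h

/-- The number of constellation points per real dimension at power `ρ`. -/
noncomputable def qamSize (C ρ : ℝ) : ℕ := ⌊√(ρ / (4 * C)) / Real.log ρ⌋₊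

/-- The numerator is (log ρ)/2 - log(4C)/2 - log log ρ, so the growing spacing log ρ costs no
degrees of freedom. -/
theorem tendsto_log_div_log {C : ℝ} (hC : 0 < C) :
    Tendsto (fun ρ => Real.log (√(ρ / (4 * C)) / Real.log ρ) / Real.log ρ) atTop (𝓝 (1 / 2)) := by
  have hL := Real.tendsto_log_atTop
  have h1 : Tendsto (fun ρ => Real.log (Real.log ρ) / Real.log ρ) atTop (𝓝 0) :=
    Real.isLittleO_log_id_atTop.tendsto_div_nhds_zero.comp hL
  have h2 : Tendsto (fun ρ => (Real.log (4 * C) / 2) / Real.log ρ) atTop (𝓝 0) :=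
    hL.const_div_atTop _
  have h3 := ((tendsto_const_nhds (x := (1 / 2 : ℝ))).sub h2).sub h1
  simp only [sub_zero] at h3
  refine h3.congr' ?_
  filter_upwards [eventually_gt_atTop 1] with ρ hρ
  have hlog : 0 < Real.log ρ := Real.log_pos hρ
  rw [Real.log_div (Real.sqrt_ne_zero'.mpr (by positivity)) hlog.ne', Real.log_sqrt (by positivity),
    Real.log_div (by positivity) (by positivity)]
  field_simp

theorem tendsto_qamRatio_atTop {C : ℝ} (hC : 0 < C) :
    Tendsto (fun ρ => √(ρ / (4 * C)) / Real.log ρ) atTop atTop := by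
  have h := Real.tendsto_exp_atTop.comp
    ((tendsto_log_div_log hC).pos_mul_atTop (by norm_num) Real.tendsto_log_atTop)
  refine h.congr' ?_
  filter_upwards [eventually_gt_atTop 1] with ρ hρ
  have hlog : 0 < Real.log ρ := Real.log_pos hρ
  simp only [Function.comp_apply]
  rw [div_mul_cancel₀ _ hlog.ne', Real.exp_log]
  positivity

theorem tendsto_log_qamSize {C : ℝ} (hC : 0 < C) :
    Tendsto (fun ρ => Real.log (qamSize C ρ) / Real.log ρ) atTop (𝓝 (1 / 2)) := by
  have h1 : Tendsto (fun ρ => Real.log ((qamSize C ρ : ℝ) / (√(ρ / (4 * C)) / Real.log ρ)))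
      atTop (𝓝 0) := by
    have := ((tendsto_nat_floor_div_atTop (R := ℝ)).comp (tendsto_qamRatio_atTop hC)).log
      one_ne_zero
    rwa [Real.log_one] at this
  have h2 := (tendsto_log_div_log hC).add (h1.div_atTop Real.tendsto_log_atTop)
  rw [add_zero] at h2
  refine h2.congr' ?_
  filter_upwards [(tendsto_qamRatio_atTop hC).eventually_ge_atTop 1] with ρ hx
  have hq : 0 < qamSize C ρ := Nat.floor_pos.mpr hx
  have hq' : (qamSize C ρ : ℝ) ≠ 0 := by exact_mod_cast hq.ne'
  rw [Real.log_div hq' (zero_lt_one.trans_le hx).ne']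
  ring

theorem qamSize_power {C ρ : ℝ} (hC : 0 < C) (hρ : 1 < ρ) :
    C * (2 * (qamSize C ρ * Real.log ρ)) ^ 2 ≤ ρ := by
  have hlog : 0 < Real.log ρ := Real.log_pos hρ
  have h1 : (qamSize C ρ : ℝ) * Real.log ρ ≤ √(ρ / (4 * C)) := by
    rw [← le_div_iff₀ hlog]
    exact Nat.floor_le (by positivity)
  have h2 : ((qamSize C ρ : ℝ) * Real.log ρ) ^ 2 ≤ ρ / (4 * C) := by
    rw [← Real.sq_sqrt (show 0 ≤ ρ / (4 * C) by positivity)]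
    exact pow_le_pow_left₀ (by positivity) h1 2
  calc C * (2 * (qamSize C ρ * Real.log ρ)) ^ 2
      = 4 * C * ((qamSize C ρ : ℝ) * Real.log ρ) ^ 2 := by ring
    _ ≤ 4 * C * (ρ / (4 * C)) := by gcongr
    _ = ρ := by field_simp

theorem linearlyAchievesDoF {H : Channel MT MR} {V : Fin 3 → Matrix (Fin MT) (Fin d) ℂ}
    {U : Fin 3 → Matrix (Fin d) (Fin MR) ℂ}
    (hUV : ∀ i j, U j * H j i * V i = if i = j then 1 else 0) :
    LinearlyAchievesDoF H V U d := by
  classical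
  obtain ⟨C, hC0, hC⟩ := exists_power_bound V
  -- The sum dominates the error probability at each receiver for spacing log ρ; `ρ⁻¹` keeps `p`
  -- positive so that its logarithm is meaningful.
  let p : ℝ → ℝ := fun ρ =>
    ρ⁻¹ + ∑ j, (antennaNoise MR).real (largeNoise (U j) (Real.log ρ / 2))
  -- Chosen so that `p ^ τ = 1 / 4`; it tends to 0 because `p` does.
  let τ : ℝ → ℝ := fun ρ => Real.log 4 / (-Real.log (p ρ))
  let r : ℝ → ℝ := fun ρ => (1 - 2 * τ ρ) * (2 * d * Real.log (qamSize C ρ)) - 2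
  have hp_pos : ∀ ρ, 0 < ρ → 0 < p ρ := fun ρ hρ =>
    add_pos_of_pos_of_nonneg (inv_pos.mpr hρ) (Finset.sum_nonneg fun _ _ => measureReal_nonneg)
  have hp : Tendsto p atTop (𝓝 0) := by
    have h1 : ∀ j, Tendsto (fun ρ => (antennaNoise MR).real (largeNoise (U j) (Real.log ρ / 2)))
        atTop (𝓝 0) := fun j =>
      (tendsto_measure_largeNoise (U j)).comp (Real.tendsto_log_atTop.atTop_div_const two_pos)
    simpa using tendsto_inv_atTop_zero.add (tendsto_finsetSum Finset.univ fun j _ => h1 j)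
  have hlogp : Tendsto (fun ρ => -Real.log (p ρ)) atTop atTop := by
    refine tendsto_neg_atBot_atTop.comp (Real.tendsto_log_nhdsGT_zero.comp ?_)
    exact tendsto_nhdsWithin_iff.mpr ⟨hp, (eventually_gt_atTop 0).mono hp_pos⟩
  have hτ : Tendsto τ atTop (𝓝 0) := hlogp.const_div_atTop _
  have hach : ∀ᶠ ρ in atTop, LinearlyAchievable H V U ρ fun _ => r ρ := by
    filter_upwards [eventually_gt_atTop 1, hlogp.eventually_gt_atTop 0,
      (tendsto_qamRatio_atTop hC0).eventually_ge_atTop 1] with ρ hρ hlp hx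
    have hp0 := hp_pos ρ (by linarith)
    refine linearlyAchievable_of_qam hUV hC (by linarith) (Real.log_pos hρ) hp0 ?_
      (fun j => ?_) (Nat.floor_pos.mpr hx) (qamSize_power hC0 hρ)
      (div_nonneg (Real.log_nonneg (by norm_num)) hlp.le) ?_
    · by_contra hcon
      have := Real.log_pos (not_le.mp hcon)
      linarith
    · have h1 := Finset.single_le_sum
        (f := fun j => (antennaNoise MR).real (largeNoise (U j) (Real.log ρ / 2)))
        (fun _ _ => measureReal_nonneg) (Finset.mem_univ j)
      have h2 : 0 ≤ ρ⁻¹ := by positivity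
      simp only [p]
      linarith
    · rw [Real.rpow_def_of_pos hp0]
      have h1 : Real.log (p ρ) * τ ρ = -Real.log 4 := by
        simp only [τ]
        have : Real.log (p ρ) ≠ 0 := by linarith [hlp] |> fun h : Real.log (p ρ) < 0 => h.ne
        field_simp
      rw [h1, Real.exp_neg, Real.exp_log (by norm_num)]
      norm_num
  -- Rates are required at every positive power; where the constellation argument is not available,
  -- rate 0 is used, which does not affect the limit.
  refine ⟨fun ρ _ => if LinearlyAchievable H V U ρ fun _ => r ρ then r ρ else 0,
    fun ρ hρ => ?_, fun _ => ?_⟩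
  · by_cases h : LinearlyAchievable H V U ρ fun _ => r ρ
    · simpa only [if_pos h] using h
    · simpa only [if_neg h] using linearlyAchievable_zero H V U hρ.le
  · have h1 : Tendsto (fun ρ => (1 - 2 * τ ρ) * (2 * d * (Real.log (qamSize C ρ) / Real.log ρ)) -
        2 / Real.log ρ) atTop (𝓝 ((1 - 2 * 0) * (2 * d * (1 / 2)) - 0)) :=
      ((tendsto_const_nhds.sub (hτ.const_mul 2)).mul
        ((tendsto_log_qamSize hC0).const_mul (2 * (d : ℝ)))).sub
        (Real.tendsto_log_atTop.const_div_atTop 2)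
    have h2 : ((1 - 2 * 0) * (2 * d * (1 / 2)) - 0 : ℝ) = d := by ring
    rw [h2] at h1
    refine h1.congr' ?_
    filter_upwards [hach] with ρ hρ
    rw [if_pos hρ]
    simp only [r]
    ring

end MIMOIC

theorem lemma2 (MT MR : ℕ) (hMT : 0 < MT) (hMR : 0 < MR)
    (ν : Fin 3 → Fin 3 → Fin MR → Fin MT → Measure ℂ)
    (hprob : ∀ j i r c, IsProbabilityMeasure (ν j i r c))
    (hcont : ∀ j i r c (z : ℂ), ν j i r c {z} = 0) :
    ∀ᵐ h ∂(MIMOIC.channelLaw ν),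
      ∃ (V : Fin 3 → Matrix (Fin MT) (Fin ⌊MIMOIC.dofStar MT MR⌋₊) ℂ)
        (U : Fin 3 → Matrix (Fin ⌊MIMOIC.dofStar MT MR⌋₊) (Fin MR) ℂ),
        MIMOIC.IsZeroForcing (fun j i => Matrix.of (h j i)) V U ∧
        MIMOIC.LinearlyAchievesDoF (fun j i => Matrix.of (h j i)) V U
          (⌊MIMOIC.dofStar MT MR⌋₊ : ℝ) := by
  filter_upwards [MIMOIC.ae_zeroForceable ν hprob hcont (MIMOIC.generically_crossAligned hMT hMR
    (Nat.floor_le (MIMOIC.dofStar_nonneg MT MR)))] with h hh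
  obtain ⟨V, U, hVU⟩ := hh
  refine ⟨V, U, ⟨fun i j hij => by rw [hVU, if_neg hij], fun j => ?_⟩,
    MIMOIC.linearlyAchievesDoF hVU⟩
  rw [hVU, if_pos rfl, Matrix.rank_one, Fintype.card_fin]
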